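/- **Theorem.** Let $\mathcal K=\mathcal K_0^2(\mathcal E^2)\cong\mathbb R^6$ be the space of Killing two-tensors of the Euclidean plane, the tensor with parameters $\beta=(\beta_1,\dots,\beta_6)$ having at $(x_1,x_2)$ the components $$K^{11}=\beta_1+2\beta_4x_2+\beta_6x_2^2,\quad K^{12}=\beta_3-\beta_4x_1-\beta_5x_2-\beta_6x_1x_2,\quad K^{22}=\beta_2+2\beta_5x_1+\beta_6x_1^2 .$$ Let $SE(2)$ act on $\mathcal K$ by push-forward and diagonally on pairs $(\alpha,\beta)\in\mathcal K\times\mathcal K$. Put $$I_1(\beta)=\beta_6,\qquad I_2(\beta)=\beta_6(\beta_1+\beta_2)-\beta_4^2-\beta_5^2,$$ $$I_3(\beta)=(\beta_6(\beta_1-\beta_2)-\beta_4^2+\beta_5^2)^2+4(\beta_6\beta_3+\beta_4\beta_5)^2 .$$ Call $\beta$ non-degenerate if $I_1(\beta)\ne0$ and $k^2=\sqrt{I_3(\beta)}/I_1(\beta)^2\neq0$; a pair is non-degenerate if both its members are. The foci of $\beta$ are the points of the plane at which the two eigenvalues of its Killing tensor coincide. A labelling of the foci of a non-degenerate pair $(\alpha,\beta)$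 is a list $F_1,F_2,F_3,F_4$ in which $F_1\ne F_2$ are foci of $\beta$ and $F_3\neq F_4$ are foci of $\alpha$; it is in general position if neither $F_1,F_2,F_3$ nor $F_2,F_3,F_4$ are collinear. For a labelling depending continuously on the pair in an open set $W$ of non-degenerate pairs, define on $W$ $$\Delta'_i=I_i(\alpha),\quad \Delta'_{3+i}=I_i(\beta)\ (i=1,2,3),\qquad \Delta'_7=d^2(F_2,F_3),\quad \Delta'_8=d^2(F_1,F_3),\quad \Delta'_9=d^2(F_2,F_4).$$ A joint invariant on an open set $V\subseteq\mathcal K\times\mathcal K$ is a function $J:V\to\mathbb R$ such that for every $z\in V$ one has $J(g z)=J(z)$ for all $g$ in some neighbourhood (depending on $z$) of the identity of $SE(2)$ with $gz\in V$. Then: 1. Every non-degenerate $\beta$ has exactly two foci, and every labelling of the foci of a non-degenerate pair $z_0$ extends to a continuous labelling over an open neighbourhood of $z_0$. 2. $I_1,I_2,I_3$ are invariant under all of $SE(2)$ on $\mathcal K$. 3. The non-degenerate pairs for which every labelling of the foci is in general position form an open dense subset of $\mathcal K\times\mathcal K$. 4. For every continuous labelling over an open set $W$ of non-degenerate pairs,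 $\Delta'_1,\dots,\Delta'_9$ are real-analytic joint invariants on $W$. 5. Let a continuous labelling over an open set $W$ of non-degenerate pairs be in general position at $z_0\in W$. Then $d\Delta'_1,\dots,d\Delta'_9$ are linearly independent at $z_0$. Moreover, for every open $V\ni z_0$ and every joint invariant $J$ on $V$ there are an open neighbourhood $V'\subseteq V\cap W$ of $z_0$, an open set $O\subseteq\mathbb R^9$ and a function $\Phi:\mathbb R^9\to\mathbb R$ with $(\Delta'_1,\dots,\Delta'_9)(V')\subseteq O$ and $$J=\Phi(\Delta'_1,\dots,\Delta'_9)\quad\text{on }V',$$ and $\Phi$ is of class $C^n$ on $O$ whenever $J$ is of class $C^n$ on $V$, for every $n\in\{0,1,2,\dots,\infty,\omega\}$. -/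

import Mathlib

open Filter Topology
open scoped ContDiff

namespace KillingE2

/-! ## Killing two-tensors of the Euclidean plane -/

/-- The parameter space of the Killing two-tensors of the Euclidean plane. The vector `β` holds the
parameters `β₁, …, β₆` as `β 0, …, β 5`. -/
abbrev KT : Type := Fin 6 → ℝ

/-- The Killing tensor with parameters `β`: the symmetric matrix of its contravariant components
`K¹¹, K¹², K²²` at the point `p = (x₁, x₂)`, in Cartesian coordinates. -/
def killingField (β : KT) (p : ℝ × ℝ) : Matrix (Fin 2) (Fin 2) ℝ :=
  !![β 0 + 2 * β 3 * p.2 + β 5 * p.2 ^ 2, β 2 - β 3 * p.1 - β 4 * p.2 - β 5 * p.1 * p.2;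
     β 2 - β 3 * p.1 - β 4 * p.2 - β 5 * p.1 * p.2, β 1 + 2 * β 4 * p.1 + β 5 * p.1 ^ 2]

/-- The Cartesian coordinate directions. -/
def dir : Fin 2 → ℝ × ℝ := ![(1, 0), (0, 1)]

/-- Killing two-tensors: smooth symmetric two-tensor fields on the plane with
`∂ᵢ Kʲᵏ + ∂ⱼ Kᵏⁱ + ∂ₖ Kⁱʲ = 0`, which is the vanishing of the Schouten bracket with the metric. -/
structure IsKillingTensor (K : ℝ × ℝ → Matrix (Fin 2) (Fin 2) ℝ) : Prop where
  smooth : ∀ i j, ContDiff ℝ ∞ (fun p => K p i j)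
  symm : ∀ p i j, K p i j = K p j i
  killing : ∀ p i j k, fderiv ℝ (fun q => K q j k) p (dir i) + fderiv ℝ (fun q => K q k i) p (dir j)
    + fderiv ℝ (fun q => K q i j) p (dir k) = 0

/-- The Killing tensors are exactly the tensor fields `killingField β`, and `β` is unique. -/
theorem isKillingTensor_iff (K : ℝ × ℝ → Matrix (Fin 2) (Fin 2) ℝ) :
    IsKillingTensor K ↔ ∃! β : KT, K = killingField β := by
  constructor
  · rintro ⟨hs, hsym, hk⟩
    have d : ∀ i j, Differentiable ℝ (fun p => K p i j) :=
      fun i j => (hs i j).differentiable (by simp)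
    have hx : ∀ i j x y, HasDerivAt (fun t => K (t, y) i j)
        (fderiv ℝ (fun q => K q i j) (x, y) (dir 0)) x := by
      intro i j x y
      exact ((d i j) (x, y)).hasFDerivAt.comp_hasDerivAt x
        ((hasDerivAt_id x).prodMk (hasDerivAt_const x y))
    have hy : ∀ i j x y, HasDerivAt (fun t => K (x, t) i j)
        (fderiv ℝ (fun q => K q i j) (x, y) (dir 1)) y := by
      intro i j x y
      exact ((d i j) (x, y)).hasFDerivAt.comp_hasDerivAt y
        ((hasDerivAt_const y x).prodMk (hasDerivAt_id y))
    have hcst : ∀ f : ℝ → ℝ, (∀ x, HasDerivAt f 0 x) → ∀ x, f x = f 0 := fun f hf x =>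
      is_const_of_deriv_eq_zero (fun t => (hf t).differentiableAt) (fun t => (hf t).deriv) x 0
    have sy : ∀ p, K p 1 0 = K p 0 1 := fun p => hsym p 1 0
    have a : ∀ x y, K (x, y) 0 0 = K (0, y) 0 0 := by
      intro x y
      refine hcst (fun t => K (t, y) 0 0) (fun t => ?_) x
      have := hk (t, y) 0 0 0
      convert hx 0 0 t y using 1
      linarith
    have b : ∀ x y, K (x, y) 1 1 = K (x, 0) 1 1 := by
      intro x y
      refine hcst (fun t => K (x, t) 1 1) (fun t => ?_) y
      have := hk (x, t) 1 1 1
      convert hy 1 1 x t using 1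
      linarith
    set f' : ℝ → ℝ := fun y => fderiv ℝ (fun q => K q 0 0) (0, y) (dir 1) with hf'
    set g' : ℝ → ℝ := fun x => fderiv ℝ (fun q => K q 1 1) (x, 0) (dir 0) with hg'
    have fy : ∀ x y, fderiv ℝ (fun q => K q 0 0) (x, y) (dir 1) = f' y := by
      intro x y
      have h1 := hy 0 0 x y
      simp only [a x] at h1
      exact h1.unique (hy 0 0 0 y)
    have gx : ∀ x y, fderiv ℝ (fun q => K q 1 1) (x, y) (dir 0) = g' x := by
      intro x y
      have h1 := hx 1 1 x y
      simp only [b _ y] at h1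
      exact h1.unique (hx 1 1 x 0)
    have h01 : ∀ x y, K (x, y) 0 1 = K (0, y) 0 1 - x * f' y / 2 := by
      intro x y
      have := hcst (fun t => K (t, y) 0 1 + t * f' y / 2) (fun t => ?_) x
      · simp at this
        linarith
      · have h1 := hk (t, y) 0 0 1
        simp only [sy, fy] at h1
        refine ((hx 0 1 t y).add (((hasDerivAt_id t).mul_const (f' y)).div_const 2)).congr_deriv ?_
        linarith
    have h10 : ∀ x y, K (x, y) 0 1 = K (x, 0) 0 1 - y * g' x / 2 := by
      intro x y
      have := hcst (fun t => K (x, t) 0 1 + t * g' x / 2) (fun t => ?_) y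
      · simp at this
        linarith
      · have h1 := hk (x, t) 0 1 1
        simp only [sy, gx] at h1
        refine ((hy 0 1 x t).add (((hasDerivAt_id t).mul_const (g' x)).div_const 2)).congr_deriv ?_
        linarith
    have key : ∀ x y, x * (f' y - f' 0) = y * (g' x - g' 0) := by
      intro x y
      have e1 := h01 x y
      have e2 := h10 x y
      have e3 := h10 0 y
      have e4 := h01 x 0
      linarith
    have k1 : ∀ y, f' y = f' 0 + y * (g' 1 - g' 0) := fun y => by linarith [key 1 y]
    have k2 : ∀ x, g' x = g' 0 + x * (g' 1 - g' 0) := fun x => by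
      have := key x 1
      have := k1 1
      linear_combination -key x 1 + x * k1 1
    set m := g' 1 - g' 0
    have ff : ∀ y, K (0, y) 0 0 = K (0, 0) 0 0 + f' 0 * y + m / 2 * y ^ 2 := by
      intro y
      have := hcst (fun t => K (0, t) 0 0 - f' 0 * t - m / 2 * t ^ 2) (fun t => ?_) y
      · simp at this
        linarith
      · refine (((hy 0 0 0 t).sub ((hasDerivAt_id t).const_mul (f' 0))).sub
          ((hasDerivAt_pow 2 t).const_mul (m / 2))).congr_deriv ?_
        rw [fy, k1]
        simp
        ring
    have gg : ∀ x, K (x, 0) 1 1 = K (0, 0) 1 1 + g' 0 * x + m / 2 * x ^ 2 := by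
      intro x
      have := hcst (fun t => K (t, 0) 1 1 - g' 0 * t - m / 2 * t ^ 2) (fun t => ?_) x
      · simp at this
        linarith
      · refine (((hx 1 1 t 0).sub ((hasDerivAt_id t).const_mul (g' 0))).sub
          ((hasDerivAt_pow 2 t).const_mul (m / 2))).congr_deriv ?_
        rw [gx, k2]
        simp
        ring
    have hh : ∀ x y, K (x, y) 0 1 = K (0, 0) 0 1 - y * g' 0 / 2 - x * f' 0 / 2 - x * y * m / 2 := by
      intro x y
      rw [h01, h10, k1]
      ring
    refine ⟨![K (0, 0) 0 0, K (0, 0) 1 1, K (0, 0) 0 1, f' 0 / 2, g' 0 / 2, m / 2], ?_, ?_⟩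
    · funext p
      obtain ⟨x, y⟩ := p
      ext i j
      fin_cases i <;> fin_cases j <;> simp [killingField]
      · rw [a, ff]; ring
      · rw [hh]; ring
      · rw [sy, hh]; ring
      · rw [b, gg]; ring
    · intro β hβ
      have e0 : K (0, 0) 0 0 = β 0 := by simp [hβ, killingField]
      have e1 : K (0, 0) 1 1 = β 1 := by simp [hβ, killingField]
      have e2 : K (0, 0) 0 1 = β 2 := by simp [hβ, killingField]
      have e3 : K (0, 1) 0 0 = β 0 + 2 * β 3 + β 5 := by simp [hβ, killingField]
      have e4 : K (0, -1) 0 0 = β 0 - 2 * β 3 + β 5 := by simp [hβ, killingField]; ring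
      have e5 : K (1, 0) 1 1 = β 1 + 2 * β 4 + β 5 := by simp [hβ, killingField]
      rw [ff] at e3 e4
      rw [gg] at e5
      funext i
      fin_cases i <;> simp <;> linarith
  · rintro ⟨β, rfl, -⟩
    refine ⟨fun i j => ?_, fun p i j => ?_, fun p i j k => ?_⟩
    · fin_cases i <;> fin_cases j <;> simp [killingField] <;> fun_prop
    · fin_cases i <;> fin_cases j <;> simp [killingField]
    · have hx : ∀ i j, fderiv ℝ (fun q => killingField β q i j) p (dir 0)
          = deriv (fun t => killingField β (t, p.2) i j) p.1 := by
        intro i j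
        have hd : DifferentiableAt ℝ (fun q => killingField β q i j) p := by
          fin_cases i <;> fin_cases j <;> simp [killingField] <;> fun_prop
        exact (hd.hasFDerivAt.comp_hasDerivAt p.1
          ((hasDerivAt_id p.1).prodMk (hasDerivAt_const p.1 p.2))).deriv.symm
      have hy : ∀ i j, fderiv ℝ (fun q => killingField β q i j) p (dir 1)
          = deriv (fun t => killingField β (p.1, t) i j) p.2 := by
        intro i j
        have hd : DifferentiableAt ℝ (fun q => killingField β q i j) p := by
          fin_cases i <;> fin_cases j <;> simp [killingField] <;> fun_prop
        exact (hd.hasFDerivAt.comp_hasDerivAt p.2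
          ((hasDerivAt_const p.2 p.1).prodMk (hasDerivAt_id p.2))).deriv.symm
      have hq : ∀ a b d t : ℝ, deriv (fun t => a + b * t + d * t ^ 2) t = b + 2 * d * t := by
        intro a b d t
        refine HasDerivAt.deriv ?_
        refine ((((hasDerivAt_id t).const_mul b).const_add a).add
          ((hasDerivAt_pow 2 t).const_mul d)).congr_deriv ?_
        simp
        ring
      have q1 := hq (β 0 + 2 * β 3 * p.2 + β 5 * p.2 ^ 2) 0 0 p.1
      have q2 := hq (β 0) (2 * β 3) (β 5) p.2
      have q3 := hq (β 2 - β 4 * p.2) (-β 3 - β 5 * p.2) 0 p.1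
      have q4 := hq (β 2 - β 3 * p.1) (-β 4 - β 5 * p.1) 0 p.2
      have q5 := hq (β 1) (2 * β 4) (β 5) p.1
      have q6 := hq (β 1 + 2 * β 4 * p.1 + β 5 * p.1 ^ 2) 0 0 p.2
      have r3 : (fun t => β 2 - β 3 * t - β 4 * p.2 - β 5 * t * p.2)
          = fun t => β 2 - β 4 * p.2 + (-β 3 - β 5 * p.2) * t + 0 * t ^ 2 := by
        funext t; ring
      have r4 : (fun t => β 2 - β 3 * p.1 - β 4 * t - β 5 * p.1 * t)
          = fun t => β 2 - β 3 * p.1 + (-β 4 - β 5 * p.1) * t + 0 * t ^ 2 := by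
        funext t; ring
      rw [← r3] at q3
      rw [← r4] at q4
      simp only [zero_mul, add_zero] at q1 q6
      fin_cases i <;> fin_cases j <;> fin_cases k <;>
        simp only [Fin.zero_eta, Fin.mk_one, hx, hy] <;> simp [killingField] <;>
        simp only [q2, q3, q4, q5] <;> ring

/-! ## The group of orientation-preserving isometries and its action -/

/-- The group `SE(2)`: an element is a translation vector `(t₁, t₂)` with a rotation matrix
`!![c, -s; s, c]`, where `c = cos θ` and `s = sin θ` for a rotation angle `θ`. -/
@[ext]
structure SE2 where
  t₁ : ℝ
  t₂ : ℝ
  c : ℝ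
  s : ℝ
  norm_eq : c ^ 2 + s ^ 2 = 1

/-- The action of `SE(2)` on points of the plane. -/
def SE2.move (g : SE2) (p : ℝ × ℝ) : ℝ × ℝ :=
  (g.c * p.1 - g.s * p.2 + g.t₁, g.s * p.1 + g.c * p.2 + g.t₂)

/-- The rotation matrix of a rigid motion. -/
def SE2.rot (g : SE2) : Matrix (Fin 2) (Fin 2) ℝ := !![g.c, -g.s; g.s, g.c]

instance : One SE2 := ⟨⟨0, 0, 1, 0, by norm_num⟩⟩

instance : Mul SE2 :=
  ⟨fun g h => ⟨g.c * h.t₁ - g.s * h.t₂ + g.t₁, g.s * h.t₁ + g.c * h.t₂ + g.t₂,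
    g.c * h.c - g.s * h.s, g.s * h.c + g.c * h.s, by
      linear_combination (h.c ^ 2 + h.s ^ 2) * g.norm_eq + h.norm_eq⟩⟩

instance : Inv SE2 :=
  ⟨fun g => ⟨-(g.c * g.t₁ + g.s * g.t₂), g.s * g.t₁ - g.c * g.t₂, g.c, -g.s, by
    linear_combination g.norm_eq⟩⟩

instance : Group SE2 :=
  Group.ofLeftAxioms
    (by
      intro a b d
      ext
      · change (a.c * b.c - a.s * b.s) * d.t₁ - (a.s * b.c + a.c * b.s) * d.t₂
            + (a.c * b.t₁ - a.s * b.t₂ + a.t₁)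
          = a.c * (b.c * d.t₁ - b.s * d.t₂ + b.t₁) - a.s * (b.s * d.t₁ + b.c * d.t₂ + b.t₂) + a.t₁
        ring
      · change (a.s * b.c + a.c * b.s) * d.t₁ + (a.c * b.c - a.s * b.s) * d.t₂
            + (a.s * b.t₁ + a.c * b.t₂ + a.t₂)
          = a.s * (b.c * d.t₁ - b.s * d.t₂ + b.t₁) + a.c * (b.s * d.t₁ + b.c * d.t₂ + b.t₂) + a.t₂
        ring
      · change (a.c * b.c - a.s * b.s) * d.c - (a.s * b.c + a.c * b.s) * d.s
          = a.c * (b.c * d.c - b.s * d.s) - a.s * (b.s * d.c + b.c * d.s)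
        ring
      · change (a.s * b.c + a.c * b.s) * d.c + (a.c * b.c - a.s * b.s) * d.s
          = a.s * (b.c * d.c - b.s * d.s) + a.c * (b.s * d.c + b.c * d.s)
        ring)
    (by
      intro a
      ext
      · change 1 * a.t₁ - 0 * a.t₂ + 0 = a.t₁
        ring
      · change 0 * a.t₁ + 1 * a.t₂ + 0 = a.t₂
        ring
      · change 1 * a.c - 0 * a.s = a.c
        ring
      · change 0 * a.c + 1 * a.s = a.s
        ring)
    (by
      intro a
      ext
      · change a.c * a.t₁ - (-a.s) * a.t₂ + -(a.c * a.t₁ + a.s * a.t₂) = 0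
        ring
      · change (-a.s) * a.t₁ + a.c * a.t₂ + (a.s * a.t₁ - a.c * a.t₂) = 0
        ring
      · change a.c * a.c - (-a.s) * a.s = 1
        linear_combination a.norm_eq
      · change (-a.s) * a.c + a.c * a.s = 0
        ring)

/-- The usual topology of `SE(2)`, as a subspace of `ℝ² × ℝ²`. -/
instance : TopologicalSpace SE2 :=
  TopologicalSpace.induced (fun g : SE2 => ((g.t₁, g.t₂), (g.c, g.s))) inferInstance

/-- The action of `SE(2)` on the parameters of a Killing tensor, induced by the action on the plane:
see `killingField_act`. -/
def act (g : SE2) (β : KT) : KT :=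
  ![β 0 * g.c ^ 2 - 2 * β 2 * g.c * g.s + β 1 * g.s ^ 2 - 2 * g.t₂ * β 3 * g.c
      - 2 * g.t₂ * β 4 * g.s + β 5 * g.t₂ ^ 2,
    β 0 * g.s ^ 2 + 2 * β 2 * g.c * g.s + β 1 * g.c ^ 2 - 2 * g.t₁ * β 4 * g.c
      + 2 * g.t₁ * β 3 * g.s + β 5 * g.t₁ ^ 2,
    (β 0 - β 1) * g.s * g.c + β 2 * (g.c ^ 2 - g.s ^ 2) + (g.t₁ * β 3 + g.t₂ * β 4) * g.c
      + (g.t₁ * β 4 - g.t₂ * β 3) * g.s - β 5 * g.t₁ * g.t₂,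
    β 3 * g.c + β 4 * g.s - β 5 * g.t₂,
    β 4 * g.c - β 3 * g.s - β 5 * g.t₁,
    β 5]

/-- The joint action of `SE(2)` on pairs `(α, β)` of Killing tensors. -/
def jointAct (g : SE2) (z : KT × KT) : KT × KT := (act g z.1, act g z.2)

/-- `act` is the push-forward of contravariant two-tensor fields by rigid motions. -/
theorem killingField_act (g : SE2) (β : KT) (p : ℝ × ℝ) :
    killingField (act g β) (g.move p) = g.rot * killingField β p * g.rot.transpose := by
  obtain ⟨t₁, t₂, c, s, h⟩ := g
  ext i j
  fin_cases i <;> fin_cases j <;>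
    simp [killingField, act, SE2.move, SE2.rot, Matrix.mul_apply, Fin.sum_univ_two]
  all_goals grind

/-- `act` is a left action of the group `SE(2)`. -/
theorem act_one (β : KT) : act 1 β = β := by
  have h₁ : (1 : SE2).t₁ = 0 := rfl
  have h₂ : (1 : SE2).t₂ = 0 := rfl
  have h₃ : (1 : SE2).c = 1 := rfl
  have h₄ : (1 : SE2).s = 0 := rfl
  funext i
  fin_cases i <;> simp [act, h₁, h₂, h₃, h₄]

theorem act_mul (g h : SE2) (β : KT) : act (g * h) β = act g (act h β) := by
  have h₁ : (g * h).t₁ = g.c * h.t₁ - g.s * h.t₂ + g.t₁ := rfl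
  have h₂ : (g * h).t₂ = g.s * h.t₁ + g.c * h.t₂ + g.t₂ := rfl
  have h₃ : (g * h).c = g.c * h.c - g.s * h.s := rfl
  have h₄ : (g * h).s = g.s * h.c + g.c * h.s := rfl
  have e := g.norm_eq
  funext i
  fin_cases i <;> simp [act, h₁, h₂, h₃, h₄] 
  all_goals grind

/-! ## Invariants, non-degeneracy and foci -/

/-- The invariant `Δ'₁ = β₆`. -/
def inv₁ (β : KT) : ℝ := β 5

/-- The invariant `Δ'₂ = β₆ (β₁ + β₂) - β₄² - β₅²`. -/
def inv₂ (β : KT) : ℝ := β 5 * (β 0 + β 1) - β 3 ^ 2 - β 4 ^ 2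

/-- The invariant `Δ'₃ = (β₆ (β₁ - β₂) - β₄² + β₅²)² + 4 (β₆ β₃ + β₄ β₅)²`. -/
def inv₃ (β : KT) : ℝ :=
  (β 5 * (β 0 - β 1) - β 3 ^ 2 + β 4 ^ 2) ^ 2 + 4 * (β 5 * β 2 + β 3 * β 4) ^ 2

/-- The invariant `k² = √Δ'₃ / (Δ'₁)²`, meaningful for `Δ'₁ ≠ 0`. -/
noncomputable def kSq (β : KT) : ℝ := Real.sqrt (inv₃ β) / inv₁ β ^ 2

/-- Non-degenerate Killing tensors, those that generate elliptic-hyperbolic webs: `k²` is defined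
and non-zero. -/
def NonDegenerate (β : KT) : Prop := inv₁ β ≠ 0 ∧ kSq β ≠ 0

/-- The foci of the web generated by a Killing tensor are its singular points, the points at which
its two eigenvalues coincide, so that the tensor is there a multiple of the metric. -/
def IsFocus (β : KT) (p : ℝ × ℝ) : Prop := ∃ lam : ℝ, killingField β p = lam • 1

/-- Explicit coordinates of the foci, for `r = 1` and `r = -1`. The sign of `β₆ β₃ + β₄ β₅` decides
which combinations of signs of the two square roots occur. -/
noncomputable def focus (r : ℝ) (β : KT) : ℝ × ℝ :=
  let σ := β 3 ^ 2 - β 4 ^ 2 + β 5 * (β 1 - β 0)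
  let ε : ℝ := if β 5 * β 2 + β 3 * β 4 < 0 then -1 else 1
  (-β 4 / β 5 + r / β 5 * Real.sqrt ((Real.sqrt (inv₃ β) - σ) / 2),
    -β 3 / β 5 + r * ε / β 5 * Real.sqrt ((Real.sqrt (inv₃ β) + σ) / 2))

theorem isFocus_iff {β : KT} (h : inv₁ β ≠ 0) (p : ℝ × ℝ) :
    IsFocus β p ↔ p = focus 1 β ∨ p = focus (-1) β := by
  have h5 : β 5 ≠ 0 := h
  obtain ⟨x, y⟩ := p
  -- in centred and scaled coordinates the foci solve `Y² - X² = σ`, `X Y = τ`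
  have e : IsFocus β (x, y) ↔
      (β 5 * y + β 3) ^ 2 - (β 5 * x + β 4) ^ 2 = β 3 ^ 2 - β 4 ^ 2 + β 5 * (β 1 - β 0) ∧
      (β 5 * x + β 4) * (β 5 * y + β 3) = β 5 * β 2 + β 3 * β 4 := by
    constructor
    · rintro ⟨l, hl⟩
      have h00 := congrFun (congrFun hl 0) 0
      have h01 := congrFun (congrFun hl 0) 1
      have h11 := congrFun (congrFun hl 1) 1
      simp [killingField] at h00 h01 h11
      constructor
      · linear_combination β 5 * h00 - β 5 * h11
      · linear_combination -β 5 * h01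
    · rintro ⟨h1, h2⟩
      have h01 : β 2 - β 3 * x - β 4 * y - β 5 * x * y = 0 :=
        mul_left_cancel₀ h5 (by linear_combination -h2)
      have h11 : β 0 + 2 * β 3 * y + β 5 * y ^ 2 = β 1 + 2 * β 4 * x + β 5 * x ^ 2 :=
        mul_left_cancel₀ h5 (by linear_combination h1)
      refine ⟨β 1 + 2 * β 4 * x + β 5 * x ^ 2, ?_⟩
      ext i j
      fin_cases i <;> fin_cases j <;> simp [killingField, h01, h11]
  rw [e]
  clear e
  simp only [focus, Prod.mk.injEq]
  have hI : inv₃ β = (β 3 ^ 2 - β 4 ^ 2 + β 5 * (β 1 - β 0)) ^ 2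
      + 4 * (β 5 * β 2 + β 3 * β 4) ^ 2 := by
    unfold inv₃; ring
  rw [hI]
  generalize β 3 ^ 2 - β 4 ^ 2 + β 5 * (β 1 - β 0) = σ
  generalize β 5 * β 2 + β 3 * β 4 = τ
  set R := Real.sqrt (σ ^ 2 + 4 * τ ^ 2) with hR
  have hR2 : R ^ 2 = σ ^ 2 + 4 * τ ^ 2 := Real.sq_sqrt (by positivity)
  have hR0 : 0 ≤ R := Real.sqrt_nonneg _
  have hσ : |σ| ≤ R := Real.abs_le_sqrt (by nlinarith [sq_nonneg τ])
  obtain ⟨hσ1, hσ2⟩ := abs_le.mp hσ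
  set A := Real.sqrt ((R - σ) / 2) with hA
  set B := Real.sqrt ((R + σ) / 2) with hB
  have hA0 : 0 ≤ A := Real.sqrt_nonneg _
  have hB0 : 0 ≤ B := Real.sqrt_nonneg _
  have hA2 : A ^ 2 = (R - σ) / 2 := Real.sq_sqrt (by linarith)
  have hB2 : B ^ 2 = (R + σ) / 2 := Real.sq_sqrt (by linarith)
  have hAB : A * B = |τ| := by
    rw [← abs_of_nonneg (mul_nonneg hA0 hB0), ← sq_eq_sq_iff_abs_eq_abs]
    rw [mul_pow, hA2, hB2]
    linarith
  set ε : ℝ := if τ < 0 then -1 else 1 with hε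
  have hε2 : ε * ε = 1 := by rw [hε]; split_ifs <;> norm_num
  have hετ : ε * |τ| = τ := by
    rw [hε]; split_ifs with ht
    · rw [abs_of_neg ht]; ring
    · rw [abs_of_nonneg (not_lt.mp ht)]; ring
  have fx : ∀ r, x = -β 4 / β 5 + r / β 5 * A ↔ β 5 * x + β 4 = r * A := by
    intro r
    constructor
    · intro hh; rw [hh]; field_simp; ring
    · intro hh; field_simp; linarith
  have fy : ∀ r, y = -β 3 / β 5 + r * ε / β 5 * B ↔ β 5 * y + β 3 = r * ε * B := by
    intro r
    constructor
    · intro hh; rw [hh]; field_simp; ring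
    · intro hh; field_simp; linarith
  rw [fx, fy, fx, fy]
  generalize β 5 * x + β 4 = X
  generalize β 5 * y + β 3 = Y
  constructor
  · rintro ⟨h1, h2⟩
    have hs : X ^ 2 + Y ^ 2 = R := by
      refine (sq_eq_sq₀ (by positivity) hR0).mp ?_
      rw [hR2, ← h1, ← h2]; ring
    have hX : X ^ 2 = A ^ 2 := by linarith
    have hY : Y ^ 2 = (ε * B) ^ 2 := by
      rw [mul_pow, hB2, pow_two ε, hε2]; linarith
    have hXY : X * Y = A * (ε * B) := by
      rw [h2, ← hετ, ← hAB]; ring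
    rcases sq_eq_sq_iff_eq_or_eq_neg.mp hX with h3 | h3 <;>
      rcases sq_eq_sq_iff_eq_or_eq_neg.mp hY with h4 | h4
    · left; constructor <;> linarith
    · rw [h3, h4] at hXY
      have : A * (ε * B) = 0 := by linarith
      rcases mul_eq_zero.mp this with h0 | h0
      · right; constructor <;> linarith
      · left; constructor <;> linarith
    · rw [h3, h4] at hXY
      have : A * (ε * B) = 0 := by linarith
      rcases mul_eq_zero.mp this with h0 | h0
      · left; constructor <;> linarith
      · right; constructor <;> linarith
    · right; constructor <;> linarith
  · have main : (ε * B) ^ 2 - A ^ 2 = σ ∧ A * (ε * B) = τ := by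
      constructor
      · rw [mul_pow, hA2, hB2, pow_two ε, hε2]; ring
      · rw [← hετ, ← hAB]; ring
    rintro (⟨h1, h2⟩ | ⟨h1, h2⟩) <;> rw [h1, h2] <;> refine ⟨?_, ?_⟩
    · linear_combination main.1
    · linear_combination main.2
    · linear_combination main.1
    · linear_combination main.2

/-- The squared Euclidean distance in the plane. -/
def sqDist (p q : ℝ × ℝ) : ℝ := (p.1 - q.1) ^ 2 + (p.2 - q.2) ^ 2

/-- The points `p 0, p 1` are the two foci `F₁, F₂` of the second tensor `β` of the pair
`z = (α, β)`, in some order, and `p 2, p 3` are the two foci `F₃, F₄` of the first tensor `α`. -/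
def IsFociLabelling (z : KT × KT) (p : Fin 4 → ℝ × ℝ) : Prop :=
  IsFocus z.2 (p 0) ∧ IsFocus z.2 (p 1) ∧ p 0 ≠ p 1 ∧
  IsFocus z.1 (p 2) ∧ IsFocus z.1 (p 3) ∧ p 2 ≠ p 3

/-- The foci are in general position: neither `F₁, F₂, F₃` nor `F₂, F₃, F₄` lie on a line. -/
def GeneralPosition (p : Fin 4 → ℝ × ℝ) : Prop :=
  ¬ Collinear ℝ {p 0, p 1, p 2} ∧ ¬ Collinear ℝ {p 1, p 2, p 3}

/-- A continuous labelling of the foci over an open set `W` of pairs of non-degenerate tensors: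
`F z` lists `F₁, F₂, F₃, F₄` for the pair `z`. -/
structure IsFociBranch (W : Set (KT × KT)) (F : KT × KT → Fin 4 → ℝ × ℝ) : Prop where
  isOpen : IsOpen W
  nonDegenerate : ∀ z ∈ W, NonDegenerate z.1 ∧ NonDegenerate z.2
  continuousOn : ContinuousOn F W
  labelling : ∀ z ∈ W, IsFociLabelling z (F z)

/-- The nine fundamental joint invariants `Δ'₁, …, Δ'₉` of a pair `z = (α, β)`, for a labelling `F`
of the foci: `Δ'₇ = d²(F₂, F₃)`, `Δ'₈ = d²(F₁, F₃)`, `Δ'₉ = d²(F₂, F₄)`. -/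
def fundInv (F : KT × KT → Fin 4 → ℝ × ℝ) (z : KT × KT) : Fin 9 → ℝ :=
  ![inv₁ z.1, inv₂ z.1, inv₃ z.1, inv₁ z.2, inv₂ z.2, inv₃ z.2,
    sqDist (F z 1) (F z 2), sqDist (F z 0) (F z 2), sqDist (F z 1) (F z 3)]

/-- A (local) joint invariant on an open set `V` of pairs of Killing tensors: a function on `V` with
`J (g • z) = J z` for each `z` in `V` and all `g` in a neighbourhood of the identity of `SE(2)`,
which may depend on `z`. -/
def IsJointInvariantOn (V : Set (KT × KT)) (J : KT × KT → ℝ) : Prop :=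
  ∀ z ∈ V, ∀ᶠ g in 𝓝 (1 : SE2), jointAct g z ∈ V → J (jointAct g z) = J z

/-- The generic pairs: non-degenerate pairs whose foci are in general position for each way to
label them. -/
def genericPairs : Set (KT × KT) :=
  {z | NonDegenerate z.1 ∧ NonDegenerate z.2 ∧
    ∀ p : Fin 4 → ℝ × ℝ, IsFociLabelling z p → GeneralPosition p}

end KillingE2

namespace KillingE2

/-! Once `inv₁` is non-zero, a Killing tensor is the same thing as the two numbers `inv₁`, `inv₂`
together with an unordered pair of foci (`eq_ofFoci`, `exists_eq_ofFoci`). A rigid motion fixes the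
two numbers and moves the foci as points (`act_ofFoci`), and `inv₃` is, for given `inv₁`, the
distance of the foci in disguise (`inv₃_ofFoci`). The joint invariant theory of a non-degenerate
pair is therefore that of four constants and four points of the plane.

The nine functions amount to those four constants and the five squared distances in the triangles
`F₁F₂F₃` and `F₂F₃F₄`, which share the side `F₂F₃`. If both triangles are non-flat, the five
distances determine the four points up to a rigid motion, as soon as it is known on which sides of
the base `F₁` and `F₄` lie; these sides are locally constant. Placing the base in a fixed position
gives an explicit analytic right inverse `invSection` of the nine functions, and the motion that
carries a nearby pair into its image is close to the identity (`IsFociBranch.exists_section`).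
Independence of the differentials follows by the chain rule, and a joint invariant `J` equals `J ∘
S` of the nine functions, where `S` is the section.

Two local points need care. Foci are square roots of a non-vanishing complex function of the tensor,
so labellings extend analytically and a continuous labelling is unique near a pair
(`exists_analyticAt_isFocus`, `IsFociBranch.eventually_eq`). The neighbourhood of the identity in
the definition of a joint invariant depends on the pair, and a connectedness argument makes it
uniform (`IsJointInvariantOn.eventually_eq`). Density of the generic pairs is seen by perturbing the
foci. -/

/-! ### Killing tensors in terms of their foci. -/

/-- The Killing tensor with foci `p`, `q` and with `inv₁ = b`, `inv₂ = m`. -/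
noncomputable def ofFoci (b m : ℝ) (p q : ℝ × ℝ) : KT :=
  ![(m / b + b * ((p.1 + q.1) ^ 2 + (p.2 + q.2) ^ 2) / 4 - b * (p.1 * q.1 - p.2 * q.2)) / 2,
    (m / b + b * ((p.1 + q.1) ^ 2 + (p.2 + q.2) ^ 2) / 4 + b * (p.1 * q.1 - p.2 * q.2)) / 2,
    -b * (p.1 * q.2 + q.1 * p.2) / 2, -b * (p.2 + q.2) / 2, -b * (p.1 + q.1) / 2, b]

theorem inv₁_ofFoci (b m : ℝ) (p q : ℝ × ℝ) : inv₁ (ofFoci b m p q) = b := by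
  simp [inv₁, ofFoci]

theorem inv₂_ofFoci {b : ℝ} (hb : b ≠ 0) (m : ℝ) (p q : ℝ × ℝ) :
    inv₂ (ofFoci b m p q) = m := by
  simp [inv₂, ofFoci]
  field_simp
  ring

/-- This is why non-degeneracy means that the foci are distinct, and why the focal distances need
not be listed among the nine invariants. -/
theorem inv₃_ofFoci (b m : ℝ) (p q : ℝ × ℝ) :
    inv₃ (ofFoci b m p q) = (b ^ 2 * sqDist p q / 4) ^ 2 := by
  simp [inv₃, ofFoci, sqDist]
  ring

theorem isFocus_iff_eqs (β : KT) (p : ℝ × ℝ) : IsFocus β p ↔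
    β 2 - β 3 * p.1 - β 4 * p.2 - β 5 * p.1 * p.2 = 0 ∧
    β 0 + 2 * β 3 * p.2 + β 5 * p.2 ^ 2 = β 1 + 2 * β 4 * p.1 + β 5 * p.1 ^ 2 := by
  constructor
  · rintro ⟨l, hl⟩
    have h00 := congrFun (congrFun hl 0) 0
    have h01 := congrFun (congrFun hl 0) 1
    have h11 := congrFun (congrFun hl 1) 1
    simp [killingField] at h00 h01 h11
    exact ⟨h01, h00.trans h11.symm⟩
  · rintro ⟨h01, h11⟩
    refine ⟨β 1 + 2 * β 4 * p.1 + β 5 * p.1 ^ 2, ?_⟩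
    ext i j
    fin_cases i <;> fin_cases j <;> simp [killingField, h01, h11]

theorem isFocus_ofFoci_left (b m : ℝ) (p q : ℝ × ℝ) : IsFocus (ofFoci b m p q) p := by
  rw [isFocus_iff_eqs]
  constructor <;> simp [ofFoci] <;> ring

theorem isFocus_ofFoci_right (b m : ℝ) (p q : ℝ × ℝ) : IsFocus (ofFoci b m p q) q := by
  rw [isFocus_iff_eqs]
  constructor <;> simp [ofFoci] <;> ring

/-- Reduces the action on parameters to the motion of points in the plane; everything about orbits
below goes through this identity. -/
theorem act_ofFoci (g : SE2) (b m : ℝ) (p q : ℝ × ℝ) :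
    act g (ofFoci b m p q) = ofFoci b m (g.move p) (g.move q) := by
  obtain ⟨t₁, t₂, c, s, h⟩ := g
  have hs : s ^ 2 = 1 - c ^ 2 := by linarith
  funext i
  fin_cases i <;> simp [act, ofFoci, SE2.move]
  · ring_nf
    simp only [hs]
    ring
  · ring_nf
    simp only [hs]
    ring
  · ring
  · ring
  · ring

theorem sqDist_move (g : SE2) (p q : ℝ × ℝ) : sqDist (g.move p) (g.move q) = sqDist p q := by
  obtain ⟨t₁, t₂, c, s, h⟩ := g
  simp only [sqDist, SE2.move]
  linear_combination ((p.1 - q.1) ^ 2 + (p.2 - q.2) ^ 2) * h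

theorem sqDist_pos {p q : ℝ × ℝ} (h : p ≠ q) : 0 < sqDist p q := by
  by_contra hc
  apply h
  unfold sqDist at hc
  have h1 : (p.1 - q.1) ^ 2 = 0 := by nlinarith [sq_nonneg (p.1 - q.1), sq_nonneg (p.2 - q.2)]
  have h2 : (p.2 - q.2) ^ 2 = 0 := by nlinarith [sq_nonneg (p.1 - q.1), sq_nonneg (p.2 - q.2)]
  exact Prod.ext (sub_eq_zero.mp (pow_eq_zero_iff two_ne_zero |>.mp h1))
    (sub_eq_zero.mp (pow_eq_zero_iff two_ne_zero |>.mp h2))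

theorem inv₃_nonneg (β : KT) : 0 ≤ inv₃ β := by
  unfold inv₃
  positivity

theorem nonDegenerate_iff (β : KT) : NonDegenerate β ↔ inv₁ β ≠ 0 ∧ inv₃ β ≠ 0 := by
  unfold NonDegenerate kSq
  refine and_congr_right fun h => ?_
  rw [div_ne_zero_iff, Real.sqrt_ne_zero (inv₃_nonneg β)]
  exact and_iff_left (pow_ne_zero 2 h)

theorem nonDegenerate_ofFoci {b : ℝ} (hb : b ≠ 0) (m : ℝ) {p q : ℝ × ℝ} (h : p ≠ q) :
    NonDegenerate (ofFoci b m p q) := by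
  rw [nonDegenerate_iff, inv₁_ofFoci, inv₃_ofFoci]
  have := sqDist_pos h
  exact ⟨hb, by positivity⟩

/-- The midpoint conditions give `β 3` and `β 4`, the two focus equations at `p` give `β 2` and `β 0
- β 1`, and `inv₂` gives `β 0 + β 1`. Since `q` enters only through the midpoint, the case of a
double focus is included. -/
theorem eq_ofFoci_of_add {β : KT} (h : inv₁ β ≠ 0) {p q : ℝ × ℝ} (hp : IsFocus β p)
    (h1 : β 5 * (p.1 + q.1) = -2 * β 4) (h2 : β 5 * (p.2 + q.2) = -2 * β 3) :
    β = ofFoci (inv₁ β) (inv₂ β) p q := by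
  have h5 : β 5 ≠ 0 := h
  rw [isFocus_iff_eqs] at hp
  obtain ⟨e1, e2⟩ := hp
  have h4 : β 4 = -β 5 * (p.1 + q.1) / 2 := by linarith
  have h3 : β 3 = -β 5 * (p.2 + q.2) / 2 := by linarith
  have hd : inv₂ β / β 5 = β 0 + β 1 - (β 3 ^ 2 + β 4 ^ 2) / β 5 := by
    unfold inv₂
    field_simp
    ring
  have hd2 : (β 3 ^ 2 + β 4 ^ 2) / β 5 = β 5 * ((p.1 + q.1) ^ 2 + (p.2 + q.2) ^ 2) / 4 := by
    rw [h3, h4]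
    field_simp
    ring
  funext i
  fin_cases i <;> simp [ofFoci, inv₁]
  · rw [hd, hd2]
    rw [h3, h4] at e2
    linarith
  · rw [hd, hd2]
    rw [h3, h4] at e2
    linarith
  · rw [h3, h4] at e1
    linarith
  · linarith
  · linarith

/-- In coordinates centred at `(-β 4 / β 5, -β 3 / β 5)` the focus equations have only quadratic and
constant terms, so they are symmetric under reflection in the centre. -/
theorem isFocus_reflect {β : KT} (h : inv₁ β ≠ 0) {p : ℝ × ℝ} (hp : IsFocus β p) :
    IsFocus β (-2 * β 4 / β 5 - p.1, -2 * β 3 / β 5 - p.2) := by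
  have h5 : β 5 ≠ 0 := h
  rw [isFocus_iff_eqs] at hp ⊢
  obtain ⟨e1, e2⟩ := hp
  constructor
  · simp only
    field_simp
    linear_combination β 5 * e1
  · simp only
    field_simp
    linear_combination β 5 * e2

theorem add_of_isFocus {β : KT} (h : inv₁ β ≠ 0) {p q : ℝ × ℝ} (hp : IsFocus β p)
    (hq : IsFocus β q) (hpq : p ≠ q) :
    β 5 * (p.1 + q.1) = -2 * β 4 ∧ β 5 * (p.2 + q.2) = -2 * β 3 := by
  have h5 : β 5 ≠ 0 := h
  have key : ∀ r s : ℝ, β 5 * ((-β 4 / β 5 + 1 / β 5 * r) + (-β 4 / β 5 + (-1) / β 5 * r))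
      = -2 * β 4 ∧ β 5 * ((-β 3 / β 5 + 1 * s / β 5 * r) + (-β 3 / β 5 + -1 * s / β 5 * r))
      = -2 * β 3 := by
    intro r s
    constructor <;> field_simp <;> ring
  rcases (isFocus_iff h p).mp hp with rfl | rfl <;> rcases (isFocus_iff h q).mp hq with rfl | rfl
  · exact absurd rfl hpq
  · simp only [focus]
    exact ⟨(key _ 1).1, (key _ _).2⟩
  · simp only [focus]
    rw [add_comm, add_comm (_ + -1 * _ / _ * _)]
    exact ⟨(key _ 1).1, (key _ _).2⟩
  · exact absurd rfl hpq

theorem eq_ofFoci {β : KT} (h : inv₁ β ≠ 0) {p q : ℝ × ℝ} (hp : IsFocus β p)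
    (hq : IsFocus β q) (hpq : p ≠ q) : β = ofFoci (inv₁ β) (inv₂ β) p q :=
  eq_ofFoci_of_add h hp (add_of_isFocus h hp hq hpq).1 (add_of_isFocus h hp hq hpq).2

/-- A Killing tensor with `inv₁ ≠ 0` is determined by its possibly coinciding foci. -/
theorem exists_eq_ofFoci {β : KT} (h : inv₁ β ≠ 0) :
    ∃ p q, β = ofFoci (inv₁ β) (inv₂ β) p q := by
  have h5 : β 5 ≠ 0 := h
  -- The second point is the reflection of the first in the centre; the two may coincide.
  refine ⟨_, _, eq_ofFoci_of_add (q := (-2 * β 4 / β 5 - (focus 1 β).1,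
    -2 * β 3 / β 5 - (focus 1 β).2)) h ((isFocus_iff h _).mpr (Or.inl rfl)) ?_ ?_⟩ <;>
  · simp only
    field_simp
    ring

/-- If the two formulas gave one point, it would be its own reflection, so `β` would have a double
focus and `inv₃` would vanish. -/
theorem focus_ne {β : KT} (h : NonDegenerate β) : focus 1 β ≠ focus (-1) β := by
  intro he
  rw [nonDegenerate_iff] at h
  have hf := (isFocus_iff h.1 _).mpr (Or.inl rfl)
  have hr := isFocus_reflect h.1 hf
  have h5 : β 5 ≠ 0 := h.1
  have hq : (-2 * β 4 / β 5 - (focus 1 β).1, -2 * β 3 / β 5 - (focus 1 β).2) = focus 1 β := by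
    rcases (isFocus_iff h.1 _).mp hr with h' | h'
    · exact h'
    · rw [h', he]
  have := eq_ofFoci_of_add (q := (-2 * β 4 / β 5 - (focus 1 β).1,
    -2 * β 3 / β 5 - (focus 1 β).2)) h.1 hf (by simp only; field_simp; ring)
    (by simp only; field_simp; ring)
  apply h.2
  rw [this, inv₃_ofFoci, hq]
  simp [sqDist]

theorem ncard_foci {β : KT} (h : NonDegenerate β) : {p : ℝ × ℝ | IsFocus β p}.ncard = 2 := by
  have : {p : ℝ × ℝ | IsFocus β p} = {focus 1 β, focus (-1) β} := by
    ext p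
    simp [isFocus_iff h.1]
  rw [this, Set.ncard_pair (focus_ne h)]

theorem eq_or_eq_of_isFocus {β : KT} (h : inv₁ β ≠ 0) {p q r : ℝ × ℝ} (hp : IsFocus β p)
    (hq : IsFocus β q) (hpq : p ≠ q) (hr : IsFocus β r) : r = p ∨ r = q := by
  rw [isFocus_iff h] at hp hq hr
  grind

/-! ### Rigid motions, foci and collinearity. -/

theorem inv₁_act (g : SE2) (β : KT) : inv₁ (act g β) = inv₁ β := by
  simp [inv₁, act]

theorem inv₂_act (g : SE2) (β : KT) : inv₂ (act g β) = inv₂ β := by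
  obtain ⟨t₁, t₂, c, s, h⟩ := g
  simp [inv₂, act]
  linear_combination (β 5 * (β 0 + β 1) - β 3 ^ 2 - β 4 ^ 2) * h

theorem inv₃_act (g : SE2) (β : KT) : inv₃ (act g β) = inv₃ β := by
  obtain ⟨t₁, t₂, c, s, h⟩ := g
  simp [inv₃, act]
  linear_combination ((β 5 * (β 0 - β 1) - β 3 ^ 2 + β 4 ^ 2) ^ 2 +
    4 * (β 5 * β 2 + β 3 * β 4) ^ 2) * (c ^ 2 + s ^ 2 + 1) * h

theorem SE2.move_injective (g : SE2) : Function.Injective g.move := by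
  intro p q h
  by_contra hne
  have := sqDist_pos hne
  rw [← sqDist_move g, h] at this
  simp [sqDist] at this

theorem isFocus_act (g : SE2) {β : KT} {p : ℝ × ℝ} (h : IsFocus β p) :
    IsFocus (act g β) (g.move p) := by
  obtain ⟨l, hl⟩ := h
  refine ⟨l, ?_⟩
  rw [killingField_act, hl]
  have := g.norm_eq
  ext i j
  fin_cases i <;> fin_cases j <;> simp [SE2.rot, Matrix.mul_apply, Fin.sum_univ_two]
  · linear_combination l * this
  · ring
  · ring
  · linear_combination l * this

theorem IsFociLabelling.act (g : SE2) {z : KT × KT} {p : Fin 4 → ℝ × ℝ}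
    (h : IsFociLabelling z p) : IsFociLabelling (jointAct g z) (fun i => g.move (p i)) :=
  ⟨isFocus_act g h.1, isFocus_act g h.2.1, g.move_injective.ne h.2.2.1,
    isFocus_act g h.2.2.2.1, isFocus_act g h.2.2.2.2.1, g.move_injective.ne h.2.2.2.2.2⟩

/-- Twice the signed area of a triangle in the plane. -/
def area (p q r : ℝ × ℝ) : ℝ := (q.1 - p.1) * (r.2 - p.2) - (q.2 - p.2) * (r.1 - p.1)

theorem collinear_iff_area (p q r : ℝ × ℝ) : Collinear ℝ {p, q, r} ↔ area p q r = 0 := by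
  rw [collinear_iff_of_mem (p₀ := p) (by simp)]
  unfold area
  constructor
  · rintro ⟨v, hv⟩
    obtain ⟨a, ha⟩ := hv q (by simp)
    obtain ⟨b, hb⟩ := hv r (by simp)
    rw [ha, hb]
    simp
    ring
  · intro h
    by_cases hq : q = p
    · subst hq
      refine ⟨r - q, fun x hx => ?_⟩
      simp at hx
      rcases hx with rfl | rfl
      · exact ⟨0, by simp⟩
      · exact ⟨1, by simp⟩
    · have hd : (q.1 - p.1) ^ 2 + (q.2 - p.2) ^ 2 ≠ 0 := (sqDist_pos hq).ne'
      refine ⟨q - p, fun x hx => ?_⟩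
      simp only [Set.mem_insert_iff, Set.mem_singleton_iff] at hx
      rcases hx with rfl | rfl | rfl
      · exact ⟨0, by simp⟩
      · exact ⟨1, by simp⟩
      -- The coefficient of the orthogonal projection of `x - p` to the line spanned by `q - p`;
      -- vanishing area means that nothing is lost by projecting.
      · refine ⟨((q.1 - p.1) * (x.1 - p.1) + (q.2 - p.2) * (x.2 - p.2)) /
          ((q.1 - p.1) ^ 2 + (q.2 - p.2) ^ 2), ?_⟩
        ext
        · simp
          field_simp
          linear_combination (-(q.2 - p.2)) * h
        · simp
          field_simp
          linear_combination ((q.1 - p.1)) * h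

theorem generalPosition_iff (p : Fin 4 → ℝ × ℝ) :
    GeneralPosition p ↔ area (p 0) (p 1) (p 2) ≠ 0 ∧ area (p 1) (p 2) (p 3) ≠ 0 := by
  unfold GeneralPosition
  rw [collinear_iff_area, collinear_iff_area]

/-! ### Analytic dependence of the foci on the tensor, and uniqueness of labellings. -/

theorem eventually_ne_of_tendsto {ι X : Type*} [TopologicalSpace X] [T2Space X] {l : Filter ι}
    {f g : ι → X} {a b : X} (hf : Tendsto f l (𝓝 a)) (hg : Tendsto g l (𝓝 b)) (h : a ≠ b) :
    ∀ᶠ t in l, f t ≠ g t :=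
  (hf.prodMk_nhds hg).eventually ((isOpen_ne_fun continuous_fst continuous_snd).mem_nhds h)

theorem isOpen_nonDegenerate : IsOpen {β : KT | NonDegenerate β} := by
  simp only [nonDegenerate_iff, Set.ofPred_and]
  refine IsOpen.inter (isOpen_ne_fun ?_ continuous_const) (isOpen_ne_fun ?_ continuous_const)
  · unfold inv₁; fun_prop
  · unfold inv₃; fun_prop

theorem isOpen_nonDegenerate_pair :
    IsOpen {z : KT × KT | NonDegenerate z.1 ∧ NonDegenerate z.2} :=
  isOpen_nonDegenerate.prod isOpen_nonDegenerate

theorem analyticAt_coord (i : Fin 6) (β : KT) : AnalyticAt ℝ (fun β : KT => β i) β :=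
  (ContinuousLinearMap.proj (R := ℝ) (φ := fun _ : Fin 6 => ℝ) i).analyticAt β

/-- The square of `(β₆ x₁ + β₅) + i (β₆ x₂ + β₄)` for a focus `(x₁, x₂)` of `β`. -/
noncomputable def focusSq (β : KT) : ℂ :=
  ((β 4 ^ 2 - β 3 ^ 2 + β 5 * (β 0 - β 1) : ℝ) : ℂ) +
    ((2 * (β 5 * β 2 + β 3 * β 4) : ℝ) : ℂ) * Complex.I

theorem focusSq_re (β : KT) : (focusSq β).re = β 4 ^ 2 - β 3 ^ 2 + β 5 * (β 0 - β 1) := by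
  simp only [focusSq, Complex.add_re, Complex.re_ofReal_mul, Complex.ofReal_re, Complex.I_re]
  ring

theorem focusSq_im (β : KT) : (focusSq β).im = 2 * (β 5 * β 2 + β 3 * β 4) := by
  simp only [focusSq, Complex.add_im, Complex.im_ofReal_mul, Complex.ofReal_im, Complex.I_im]
  ring

/-- Up to non-zero factors, the two real focus equations are the real and imaginary parts of a
single complex one, so finding the foci is extracting a complex square root. -/
theorem isFocus_iff_focusSq {β : KT} (h : inv₁ β ≠ 0) (ξ : ℂ) :
    IsFocus β ((ξ.re - β 4) / β 5, (ξ.im - β 3) / β 5) ↔ ξ ^ 2 = focusSq β := by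
  have h5 : β 5 ≠ 0 := h
  rw [isFocus_iff_eqs, Complex.ext_iff, focusSq_re, focusSq_im, pow_two ξ, Complex.mul_re,
    Complex.mul_im]
  simp only
  constructor
  · rintro ⟨h1, h2⟩
    field_simp at h1 h2
    constructor
    · linear_combination -h2
    · linear_combination -2 * h1
  · rintro ⟨h1, h2⟩
    field_simp
    constructor
    · linear_combination -h2 / 2
    · linear_combination -h1

/-- The squared modulus of `focusSq β` is `inv₃ β`. -/
theorem focusSq_ne_zero {β : KT} (h : inv₃ β ≠ 0) : focusSq β ≠ 0 := by
  intro h0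
  apply h
  have h1 := focusSq_re β
  have h2 := focusSq_im β
  rw [h0] at h1 h2
  simp only [Complex.zero_re, Complex.zero_im] at h1 h2
  unfold inv₃
  linear_combination (β 4 ^ 2 - β 3 ^ 2 + β 5 * (β 0 - β 1)) * (-h1) +
    2 * (β 5 * β 2 + β 3 * β 4) * (-h2)

theorem analyticAt_focusSq (β : KT) : AnalyticAt ℝ focusSq β := by
  have hc := fun i => analyticAt_coord i β
  unfold focusSq
  refine AnalyticAt.add ?_ (AnalyticAt.mul ?_ analyticAt_const)
  · refine (Complex.ofRealCLM.analyticAt _).comp ?_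
    exact (((hc 4).pow 2).sub ((hc 3).pow 2)).add ((hc 5).mul ((hc 0).sub (hc 1)))
  · refine (Complex.ofRealCLM.analyticAt _).comp ?_
    exact analyticAt_const.mul (((hc 5).mul (hc 2)).add ((hc 3).mul (hc 4)))

theorem exists_analyticAt_isFocus {β₀ : KT} (h : NonDegenerate β₀) {p : ℝ × ℝ}
    (hp : IsFocus β₀ p) : ∃ f : KT → ℝ × ℝ, AnalyticAt ℝ f β₀ ∧ f β₀ = p ∧
      ∀ᶠ β in 𝓝 β₀, IsFocus β (f β) := by
  have h' := (nonDegenerate_iff β₀).mp h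
  have h5 : β₀ 5 ≠ 0 := h'.1
  set ξ₀ : ℂ := ⟨β₀ 5 * p.1 + β₀ 4, β₀ 5 * p.2 + β₀ 3⟩ with hξ
  have hpe : p = ((ξ₀.re - β₀ 4) / β₀ 5, (ξ₀.im - β₀ 3) / β₀ 5) := by
    ext <;> simp [hξ] <;> field_simp
  have hsq : ξ₀ ^ 2 = focusSq β₀ := (isFocus_iff_focusSq h'.1 ξ₀).mp (hpe ▸ hp)
  have hw := focusSq_ne_zero h'.2
  have hξ0 : ξ₀ ≠ 0 := fun h0 => hw (by rw [← hsq, h0]; simp)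
  -- Division by the value at `β₀` brings the argument to `1`, away from the cut of the principal
  -- root; the factor `ξ₀` selects the root that belongs to `p`.
  let S : KT → ℂ := fun β => ξ₀ * (focusSq β / focusSq β₀) ^ (((2 : ℕ) : ℂ)⁻¹)
  have hS0 : S β₀ = ξ₀ := by simp [S, hw]
  have hS : ∀ β, S β ^ 2 = focusSq β := by
    intro β
    simp only [S]
    rw [mul_pow, Complex.cpow_nat_inv_pow _ two_ne_zero, hsq]
    field_simp
  have hSa : AnalyticAt ℝ S β₀ := by
    refine analyticAt_const.mul ?_
    have hpow : AnalyticAt ℝ (fun z : ℂ => z ^ (((2 : ℕ) : ℂ)⁻¹)) (focusSq β₀ / focusSq β₀) := by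
      refine AnalyticAt.restrictScalars (𝕜' := ℂ) (AnalyticAt.cpow analyticAt_id analyticAt_const ?_)
      simp [div_self hw, Complex.one_mem_slitPlane]
    exact hpow.comp (f := fun β => focusSq β / focusSq β₀)
      (by
        simp only [div_eq_mul_inv]
        exact (analyticAt_focusSq β₀).mul analyticAt_const)
  refine ⟨fun β => (((S β).re - β 4) / β 5, ((S β).im - β 3) / β 5), ?_, ?_, ?_⟩
  · refine AnalyticAt.prod ?_ ?_
    · exact (((Complex.reCLM.analyticAt _).comp hSa).sub (analyticAt_coord 4 _)).div
        (analyticAt_coord 5 _) h5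
    · exact (((Complex.imCLM.analyticAt _).comp hSa).sub (analyticAt_coord 3 _)).div
        (analyticAt_coord 5 _) h5
  · simp only [hS0]
    exact hpe.symm
  · filter_upwards [isOpen_nonDegenerate.mem_nhds h] with β hβ
    exact (isFocus_iff_focusSq hβ.1 _).mpr (hS β)

theorem exists_analyticAt_labelling {z₀ : KT × KT} (h₁ : NonDegenerate z₀.1)
    (h₂ : NonDegenerate z₀.2) {p : Fin 4 → ℝ × ℝ} (hp : IsFociLabelling z₀ p) :
    ∃ F : KT × KT → Fin 4 → ℝ × ℝ, AnalyticAt ℝ F z₀ ∧ F z₀ = p ∧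
      ∀ᶠ z in 𝓝 z₀, IsFociLabelling z (F z) := by
  obtain ⟨p0, p1, p01, p2, p3, p23⟩ := hp
  obtain ⟨f0, a0, e0, i0⟩ := exists_analyticAt_isFocus h₂ p0
  obtain ⟨f1, a1, e1, i1⟩ := exists_analyticAt_isFocus h₂ p1
  obtain ⟨f2, a2, e2, i2⟩ := exists_analyticAt_isFocus h₁ p2
  obtain ⟨f3, a3, e3, i3⟩ := exists_analyticAt_isFocus h₁ p3
  have t1 : Tendsto (fun z : KT × KT => z.1) (𝓝 z₀) (𝓝 z₀.1) := continuous_fst.continuousAt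
  have t2 : Tendsto (fun z : KT × KT => z.2) (𝓝 z₀) (𝓝 z₀.2) := continuous_snd.continuousAt
  have n01 : ∀ᶠ β in 𝓝 z₀.2, f0 β ≠ f1 β :=
    eventually_ne_of_tendsto a0.continuousAt a1.continuousAt (by rwa [e0, e1])
  have n23 : ∀ᶠ β in 𝓝 z₀.1, f2 β ≠ f3 β :=
    eventually_ne_of_tendsto a2.continuousAt a3.continuousAt (by rwa [e2, e3])
  refine ⟨fun z => ![f0 z.2, f1 z.2, f2 z.1, f3 z.1], ?_, ?_, ?_⟩
  · refine AnalyticAt.pi fun i => ?_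
    have s1 : AnalyticAt ℝ (fun z : KT × KT => z.1) z₀ := analyticAt_fst
    have s2 : AnalyticAt ℝ (fun z : KT × KT => z.2) z₀ := analyticAt_snd
    fin_cases i
    · exact a0.comp s2
    · exact a1.comp s2
    · exact a2.comp s1
    · exact a3.comp s1
  · funext i
    fin_cases i <;> simp [*]
  · filter_upwards [t2.eventually i0, t2.eventually i1, t1.eventually i2, t1.eventually i3,
      t2.eventually n01, t1.eventually n23] with z b0 b1 b2 b3 b01 b23
    exact ⟨b0, b1, b01, b2, b3, b23⟩

theorem exists_isFociBranch {z₀ : KT × KT} (h₁ : NonDegenerate z₀.1)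
    (h₂ : NonDegenerate z₀.2) {p : Fin 4 → ℝ × ℝ} (hp : IsFociLabelling z₀ p) :
    ∃ W F, IsFociBranch W F ∧ z₀ ∈ W ∧ F z₀ = p := by
  obtain ⟨F, ha, h0, hl⟩ := exists_analyticAt_labelling h₁ h₂ hp
  have hn : ∀ᶠ z in 𝓝 z₀, NonDegenerate z.1 ∧ NonDegenerate z.2 :=
    isOpen_nonDegenerate_pair.mem_nhds ⟨h₁, h₂⟩
  obtain ⟨W, hW, hWo, hz⟩ := eventually_nhds_iff.mp (ha.eventually_analyticAt.and (hl.and hn))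
  exact ⟨W, F, ⟨hWo, fun z h => (hW z h).2.2,
    fun z h => (hW z h).1.continuousAt.continuousWithinAt, fun z h => (hW z h).2.1⟩, hz, h0⟩

theorem IsFociLabelling.eq_of_ne {z : KT × KT} (h₁ : NonDegenerate z.1)
    (h₂ : NonDegenerate z.2) {p q : Fin 4 → ℝ × ℝ} (hp : IsFociLabelling z p)
    (hq : IsFociLabelling z q) (h0 : q 0 ≠ p 1) (h1 : q 1 ≠ p 0) (h2 : q 2 ≠ p 3)
    (h3 : q 3 ≠ p 2) : q = p := by
  obtain ⟨p0, p1, p01, p2, p3, p23⟩ := hp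
  obtain ⟨q0, q1, q01, q2, q3, q23⟩ := hq
  funext i
  fin_cases i
  · exact (eq_or_eq_of_isFocus h₂.1 p0 p1 p01 q0).resolve_right h0
  · exact (eq_or_eq_of_isFocus h₂.1 p0 p1 p01 q1).resolve_left h1
  · exact (eq_or_eq_of_isFocus h₁.1 p2 p3 p23 q2).resolve_right h2
  · exact (eq_or_eq_of_isFocus h₁.1 p2 p3 p23 q3).resolve_left h3

/-- Labellings converging to the value of a branch eventually agree with that branch. -/
theorem IsFociBranch.eventually_eq {W : Set (KT × KT)} {F : KT × KT → Fin 4 → ℝ × ℝ}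
    (hF : IsFociBranch W F) {z₀ : KT × KT} (hz₀ : z₀ ∈ W) {ι : Type*} {l : Filter ι}
    {u : ι → KT × KT} {p : ι → Fin 4 → ℝ × ℝ} (hu : Tendsto u l (𝓝 z₀))
    (hp : Tendsto p l (𝓝 (F z₀))) (hl : ∀ᶠ t in l, IsFociLabelling (u t) (p t)) :
    ∀ᶠ t in l, F (u t) = p t := by
  have hFu : Tendsto (fun t => F (u t)) l (𝓝 (F z₀)) :=
    ((hF.continuousOn.continuousAt (hF.isOpen.mem_nhds hz₀)).tendsto).comp hu
  obtain ⟨-, -, h01, -, -, h23⟩ := hF.labelling z₀ hz₀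
  rw [tendsto_pi_nhds] at hFu hp
  -- Two labellings of one pair can differ only by exchanging foci of the same tensor. The limits of
  -- the two labels are distinct, so no exchange occurs near `z₀`.
  have hne : ∀ i j, F z₀ i ≠ F z₀ j → ∀ᶠ t in l, F (u t) i ≠ p t j :=
    fun i j hij => eventually_ne_of_tendsto (hFu i) (hp j) hij
  filter_upwards [hl, hu.eventually (hF.isOpen.mem_nhds hz₀), hne 0 1 h01, hne 1 0 h01.symm,
    hne 2 3 h23, hne 3 2 h23.symm] with t a b c d e f
  exact a.eq_of_ne (hF.nonDegenerate _ b).1 (hF.nonDegenerate _ b).2 (hF.labelling _ b) c d e f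

/-- Continuity suffices for analyticity, because the labelling must agree near `z₀` with the
analytic one that has the same value there. -/
theorem IsFociBranch.analyticAt {W : Set (KT × KT)} {F : KT × KT → Fin 4 → ℝ × ℝ}
    (hF : IsFociBranch W F) {z₀ : KT × KT} (hz₀ : z₀ ∈ W) : AnalyticAt ℝ F z₀ := by
  obtain ⟨G, ha, h0, hl⟩ := exists_analyticAt_labelling (hF.nonDegenerate z₀ hz₀).1
    (hF.nonDegenerate z₀ hz₀).2 (hF.labelling z₀ hz₀)
  refine ha.congr ?_
  have := hF.eventually_eq hz₀ tendsto_id (h0 ▸ ha.continuousAt.tendsto) hl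
  filter_upwards [this] with t ht using ht.symm

theorem IsFociBranch.analyticAt_fundInv {W : Set (KT × KT)} {F : KT × KT → Fin 4 → ℝ × ℝ}
    (hF : IsFociBranch W F) {z₀ : KT × KT} (hz₀ : z₀ ∈ W) (i : Fin 9) :
    AnalyticAt ℝ (fun z => fundInv F z i) z₀ := by
  have hf := analyticAt_pi_iff.mp (hF.analyticAt hz₀)
  have c1 : ∀ i, AnalyticAt ℝ (fun z : KT × KT => z.1 i) z₀ := fun i =>
    (analyticAt_coord i _).comp analyticAt_fst
  have c2 : ∀ i, AnalyticAt ℝ (fun z : KT × KT => z.2 i) z₀ := fun i =>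
    (analyticAt_coord i _).comp analyticAt_snd
  have x1 : ∀ i, AnalyticAt ℝ (fun z => (F z i).1) z₀ := fun i => analyticAt_fst.comp (hf i)
  have x2 : ∀ i, AnalyticAt ℝ (fun z => (F z i).2) z₀ := fun i => analyticAt_snd.comp (hf i)
  have hd : ∀ i j, AnalyticAt ℝ (fun z => sqDist (F z i) (F z j)) z₀ := fun i j =>
    (((x1 i).sub (x1 j)).pow 2).add (((x2 i).sub (x2 j)).pow 2)
  -- Here `c` stands for the six coordinates of either member of the pair, so that one argument
  -- serves both.
  have h3 : ∀ c : Fin 6 → KT × KT → ℝ, (∀ i, AnalyticAt ℝ (c i) z₀) →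
      AnalyticAt ℝ (fun z => (c 5 z * (c 0 z - c 1 z) - c 3 z ^ 2 + c 4 z ^ 2) ^ 2 +
        4 * (c 5 z * c 2 z + c 3 z * c 4 z) ^ 2) z₀ := fun c h =>
    ((((((h 5).mul ((h 0).sub (h 1))).sub ((h 3).pow 2)).add ((h 4).pow 2)).pow 2)).add
      (analyticAt_const.mul ((((h 5).mul (h 2)).add ((h 3).mul (h 4))).pow 2))
  have h2 : ∀ c : Fin 6 → KT × KT → ℝ, (∀ i, AnalyticAt ℝ (c i) z₀) →
      AnalyticAt ℝ (fun z => c 5 z * (c 0 z + c 1 z) - c 3 z ^ 2 - c 4 z ^ 2) z₀ := fun c h =>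
    (((h 5).mul ((h 0).add (h 1))).sub ((h 3).pow 2)).sub ((h 4).pow 2)
  fin_cases i
  · exact c1 5
  · exact h2 _ c1
  · exact h3 _ c1
  · exact c2 5
  · exact h2 _ c2
  · exact h3 _ c2
  · exact hd 1 2
  · exact hd 0 2
  · exact hd 1 3

/-! ### Invariance of the nine functions under small motions. -/

theorem SE2.continuous_coords : Continuous fun g : SE2 => ((g.t₁, g.t₂), (g.c, g.s)) :=
  continuous_induced_dom

theorem SE2.continuous_t₁ : Continuous SE2.t₁ :=
  (continuous_fst.comp continuous_fst).comp SE2.continuous_coords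

theorem SE2.continuous_t₂ : Continuous SE2.t₂ :=
  (continuous_snd.comp continuous_fst).comp SE2.continuous_coords

theorem SE2.continuous_c : Continuous SE2.c :=
  (continuous_fst.comp continuous_snd).comp SE2.continuous_coords

theorem SE2.continuous_s : Continuous SE2.s :=
  (continuous_snd.comp continuous_snd).comp SE2.continuous_coords

theorem continuous_jointAct : Continuous fun x : SE2 × (KT × KT) => jointAct x.1 x.2 := by
  have h1 := SE2.continuous_t₁
  have h2 := SE2.continuous_t₂
  have h3 := SE2.continuous_c
  have h4 := SE2.continuous_s
  unfold jointAct act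
  refine Continuous.prodMk ?_ ?_ <;>
  · refine continuous_pi fun i => ?_
    fin_cases i <;> simp <;> fun_prop

theorem SE2.continuous_move (p : ℝ × ℝ) : Continuous fun g : SE2 => g.move p := by
  have h1 := SE2.continuous_t₁
  have h2 := SE2.continuous_t₂
  have h3 := SE2.continuous_c
  have h4 := SE2.continuous_s
  unfold SE2.move
  fun_prop

theorem jointAct_one (z : KT × KT) : jointAct 1 z = z := by
  simp [jointAct, act_one]

theorem jointAct_mul (g h : SE2) (z : KT × KT) :
    jointAct (g * h) z = jointAct g (jointAct h z) := by
  simp [jointAct, act_mul]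

theorem SE2.move_one (p : ℝ × ℝ) : SE2.move 1 p = p := by
  have h₁ : (1 : SE2).t₁ = 0 := rfl
  have h₂ : (1 : SE2).t₂ = 0 := rfl
  have h₃ : (1 : SE2).c = 1 := rfl
  have h₄ : (1 : SE2).s = 0 := rfl
  simp [SE2.move, h₁, h₂, h₃, h₄]

theorem fundInv_jointAct {F : KT × KT → Fin 4 → ℝ × ℝ} {g : SE2} {z : KT × KT}
    (h : F (jointAct g z) = fun i => g.move (F z i)) :
    fundInv F (jointAct g z) = fundInv F z := by
  simp only [fundInv, h, sqDist_move]
  simp only [jointAct, inv₁_act, inv₂_act, inv₃_act]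

/-- The labelling transported by `g` tends to `F z` as `g` tends to the identity, hence it is the
value of `F` at the moved pair. A motion far from the identity might exchange labels. -/
theorem IsFociBranch.isJointInvariantOn_fundInv {W : Set (KT × KT)}
    {F : KT × KT → Fin 4 → ℝ × ℝ} (hF : IsFociBranch W F) (i : Fin 9) :
    IsJointInvariantOn W (fun z => fundInv F z i) := by
  intro z hz
  have hu : Tendsto (fun g : SE2 => jointAct g z) (𝓝 1) (𝓝 z) := by
    have : Continuous fun g : SE2 => jointAct g z :=
      continuous_jointAct.comp (continuous_id.prodMk continuous_const)
    simpa [jointAct_one] using this.tendsto 1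
  have hp : Tendsto (fun (g : SE2) i => g.move (F z i)) (𝓝 1) (𝓝 (F z)) := by
    have : Continuous fun (g : SE2) i => g.move (F z i) :=
      continuous_pi fun i => SE2.continuous_move _
    simpa [SE2.move_one] using this.tendsto 1
  filter_upwards [hF.eventually_eq hz hu hp (Eventually.of_forall fun g =>
    (hF.labelling z hz).act g)] with g hg _
  exact congrFun (fundInv_jointAct hg) i

/-! ### Generic pairs form an open dense set. -/

/-- No three of the four points are collinear. -/
def NoThreeCollinear (p : Fin 4 → ℝ × ℝ) : Prop :=
  area (p 0) (p 1) (p 2) ≠ 0 ∧ area (p 1) (p 2) (p 3) ≠ 0 ∧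
  area (p 0) (p 1) (p 3) ≠ 0 ∧ area (p 0) (p 2) (p 3) ≠ 0

theorem area_swap_left (p q r : ℝ × ℝ) : area q p r = -area p q r := by
  unfold area; ring

theorem area_swap_right (p q r : ℝ × ℝ) : area p r q = -area p q r := by
  unfold area; ring

theorem mem_genericPairs_iff {z : KT × KT} (h₁ : NonDegenerate z.1) (h₂ : NonDegenerate z.2)
    {p : Fin 4 → ℝ × ℝ} (hp : IsFociLabelling z p) :
    z ∈ genericPairs ↔ NoThreeCollinear p := by
  have hp' := hp
  obtain ⟨p0, p1, p01, p2, p3, p23⟩ := hp'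
  constructor
  · rintro ⟨-, -, h⟩
    have a := (generalPosition_iff _).mp (h p hp)
    -- Exchanging the labels in both pairs of foci produces the two triples that are missing from
    -- the definition of general position.
    have b := (generalPosition_iff _).mp
      (h ![p 1, p 0, p 3, p 2] ⟨p1, p0, p01.symm, p3, p2, p23.symm⟩)
    obtain ⟨b1, b2⟩ := b
    simp only [Matrix.cons_val] at b1 b2
    rw [area_swap_left, neg_ne_zero] at b1
    rw [area_swap_right, neg_ne_zero] at b2
    exact ⟨a.1, a.2, b1, b2⟩
  · rintro ⟨a1, a2, a3, a4⟩
    refine ⟨h₁, h₂, fun q ⟨q0, q1, q01, q2, q3, q23⟩ => (generalPosition_iff q).mpr ?_⟩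
    rcases eq_or_eq_of_isFocus h₂.1 p0 p1 p01 q0 with e0 | e0 <;>
    rcases eq_or_eq_of_isFocus h₂.1 p0 p1 p01 q1 with e1 | e1 <;>
    rcases eq_or_eq_of_isFocus h₁.1 p2 p3 p23 q2 with e2 | e2 <;>
    rcases eq_or_eq_of_isFocus h₁.1 p2 p3 p23 q3 with e3 | e3 <;>
    first
    | exact absurd (e0.trans e1.symm) q01
    | exact absurd (e2.trans e3.symm) q23
    | (rw [e0, e1, e2, e3]
       first
       | exact ⟨a1, a2⟩
       | (rw [area_swap_right _ (p 2), neg_ne_zero]; exact ⟨a3, a2⟩)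
       | (rw [area_swap_left (p 0) (p 1), neg_ne_zero]; exact ⟨a1, a4⟩)
       | (rw [area_swap_left (p 0) (p 1), neg_ne_zero, area_swap_right _ (p 2), neg_ne_zero]
          exact ⟨a3, a4⟩))

theorem exists_isFociLabelling {z : KT × KT} (h₁ : NonDegenerate z.1) (h₂ : NonDegenerate z.2) :
    ∃ p, IsFociLabelling z p :=
  ⟨![focus 1 z.2, focus (-1) z.2, focus 1 z.1, focus (-1) z.1],
    (isFocus_iff h₂.1 _).mpr (Or.inl rfl), (isFocus_iff h₂.1 _).mpr (Or.inr rfl), focus_ne h₂,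
    (isFocus_iff h₁.1 _).mpr (Or.inl rfl), (isFocus_iff h₁.1 _).mpr (Or.inr rfl), focus_ne h₁⟩

theorem isOpen_noThreeCollinear : IsOpen {p | NoThreeCollinear p} := by
  unfold NoThreeCollinear area
  simp only [Set.ofPred_and]
  refine .inter ?_ (.inter ?_ (.inter ?_ ?_)) <;>
  · refine isOpen_ne_fun ?_ continuous_const
    fun_prop

theorem isOpen_genericPairs : IsOpen genericPairs := by
  rw [isOpen_iff_mem_nhds]
  intro z₀ hz₀
  obtain ⟨p, hp⟩ := exists_isFociLabelling hz₀.1 hz₀.2.1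
  obtain ⟨W, F, hF, hW, rfl⟩ := exists_isFociBranch hz₀.1 hz₀.2.1 hp
  have hg := (mem_genericPairs_iff hz₀.1 hz₀.2.1 hp).mp hz₀
  filter_upwards [hF.isOpen.mem_nhds hW, (hF.analyticAt hW).continuousAt.eventually
    (isOpen_noThreeCollinear.mem_nhds hg)] with z hz hz'
  exact (mem_genericPairs_iff (hF.nonDegenerate z hz).1 (hF.nonDegenerate z hz).2
    (hF.labelling z hz)).mpr hz'

/-- An analytic function either vanishes identically near the point or has no other zeros nearby; in
the first case differentiation at `0` kills `b`, and then the derivative at a point `t ≠ 0`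
contradicts `c ≠ 0`. -/
theorem eventually_quadratic_ne_zero (a b : ℝ) {c : ℝ} (hc : c ≠ 0) :
    ∀ᶠ t in 𝓝[≠] (0 : ℝ), a + b * t + c * t ^ 2 ≠ 0 := by
  have hd : ∀ t, HasDerivAt (fun t => a + b * t + c * t ^ 2) (b + 2 * c * t) t := fun t => by
    refine (((hasDerivAt_id t).const_mul b).const_add a |>.add
      ((hasDerivAt_pow 2 t).const_mul c)).congr_deriv ?_
    simp
    ring
  have ha : AnalyticAt ℝ (fun t : ℝ => a + b * t + c * t ^ 2) 0 := by fun_prop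
  rcases ha.eventually_eq_zero_or_eventually_ne_zero with h | h
  · exfalso
    have h1 : ∀ᶠ t in 𝓝 (0 : ℝ), b + 2 * c * t = 0 := by
      filter_upwards [h.eventually_nhds] with t ht
      rw [← (hd t).deriv, Filter.EventuallyEq.deriv_eq (f := fun _ => (0 : ℝ)) ht]
      simp
    have hb : b = 0 := by simpa using h1.self_of_nhds
    have h2 : ∀ᶠ t in 𝓝[≠] (0 : ℝ), False := by
      filter_upwards [h1.filter_mono nhdsWithin_le_nhds, self_mem_nhdsWithin] with t ht ht0
      rw [hb] at ht
      have : c * t = 0 := by linarith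
      rcases mul_eq_zero.mp this with h | h
      · exact hc h
      · exact ht0 h
    exact h2.exists.elim fun _ h => h
  · exact h

/-- Four points no three of which are collinear. -/
def square : Fin 4 → ℝ × ℝ := ![(0, 0), (1, 0), (0, 1), (1, 1)]

theorem eventually_noThreeCollinear (p : Fin 4 → ℝ × ℝ) :
    ∀ᶠ t in 𝓝[≠] (0 : ℝ), NoThreeCollinear (fun i => p i + t • square i) := by
  have key : ∀ i j k, area (square i) (square j) (square k) ≠ 0 → ∀ᶠ t in 𝓝[≠] (0 : ℝ),
      area (p i + t • square i) (p j + t • square j) (p k + t • square k) ≠ 0 := by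
    intro i j k h
    -- The area of a perturbed triple is quadratic in `t`, with the area of the corresponding triple
    -- of `square` as leading coefficient.
    filter_upwards [eventually_quadratic_ne_zero (area (p i) (p j) (p k))
      (((p j).1 - (p i).1) * ((square k).2 - (square i).2)
        + ((square j).1 - (square i).1) * ((p k).2 - (p i).2)
        - ((p j).2 - (p i).2) * ((square k).1 - (square i).1)
        - ((square j).2 - (square i).2) * ((p k).1 - (p i).1)) h] with t ht h0
    apply ht
    rw [← h0]
    simp only [area, Prod.fst_add, Prod.snd_add, Prod.smul_fst, Prod.smul_snd, smul_eq_mul]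
    ring
  filter_upwards [key 0 1 2 (by simp [square, area]), key 1 2 3 (by simp [square, area]),
    key 0 1 3 (by simp [square, area]), key 0 2 3 (by simp [square, area])] with t a b c d
  exact ⟨a, b, c, d⟩

theorem NoThreeCollinear.ne {p : Fin 4 → ℝ × ℝ} (h : NoThreeCollinear p) :
    p 0 ≠ p 1 ∧ p 2 ≠ p 3 := by
  constructor <;> intro he
  · apply h.1
    rw [he]
    simp [area]
  · apply h.2.1
    rw [he]
    unfold area
    ring

theorem isFociLabelling_ofFoci (a b m n : ℝ) {p : Fin 4 → ℝ × ℝ} (h₁ : p 0 ≠ p 1)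
    (h₂ : p 2 ≠ p 3) :
    IsFociLabelling (ofFoci a m (p 2) (p 3), ofFoci b n (p 0) (p 1)) p :=
  ⟨isFocus_ofFoci_left _ _ _ _, isFocus_ofFoci_right _ _ _ _, h₁,
    isFocus_ofFoci_left _ _ _ _, isFocus_ofFoci_right _ _ _ _, h₂⟩

theorem ofFoci_mem_genericPairs {a b : ℝ} (ha : a ≠ 0) (hb : b ≠ 0) (m n : ℝ)
    {p : Fin 4 → ℝ × ℝ} (hp : NoThreeCollinear p) :
    (ofFoci a m (p 2) (p 3), ofFoci b n (p 0) (p 1)) ∈ genericPairs :=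
  (mem_genericPairs_iff (nonDegenerate_ofFoci ha m hp.ne.2) (nonDegenerate_ofFoci hb n hp.ne.1)
    (isFociLabelling_ofFoci a b m n hp.ne.1 hp.ne.2)).mpr hp

theorem continuous_ofFoci (b m : ℝ) {X : Type*} [TopologicalSpace X] {f g : X → ℝ × ℝ}
    (hf : Continuous f) (hg : Continuous g) : Continuous fun x => ofFoci b m (f x) (g x) := by
  unfold ofFoci
  refine continuous_pi fun i => ?_
  fin_cases i <;> simp <;> fun_prop

/-- With `inv₁` and `inv₂` kept fixed, the possibly coinciding foci are moved along `square`, which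
makes them generic for small `t ≠ 0`. -/
theorem mem_closure_genericPairs {z : KT × KT} (h₁ : inv₁ z.1 ≠ 0) (h₂ : inv₁ z.2 ≠ 0) :
    z ∈ closure genericPairs := by
  obtain ⟨p, q, hα⟩ := exists_eq_ofFoci h₁
  obtain ⟨r, s, hβ⟩ := exists_eq_ofFoci h₂
  set P : Fin 4 → ℝ × ℝ := ![r, s, p, q]
  have hP : ∀ i, Continuous fun t : ℝ => P i + t • square i := fun i => by fun_prop
  have hc : Continuous fun t : ℝ =>
      (ofFoci (inv₁ z.1) (inv₂ z.1) (P 2 + t • square 2) (P 3 + t • square 3),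
        ofFoci (inv₁ z.2) (inv₂ z.2) (P 0 + t • square 0) (P 1 + t • square 1)) :=
    (continuous_ofFoci _ _ (hP 2) (hP 3)).prodMk (continuous_ofFoci _ _ (hP 0) (hP 1))
  refine mem_closure_of_tendsto (b := 𝓝[≠] (0 : ℝ)) (f := fun t : ℝ =>
      (ofFoci (inv₁ z.1) (inv₂ z.1) (P 2 + t • square 2) (P 3 + t • square 3),
        ofFoci (inv₁ z.2) (inv₂ z.2) (P 0 + t • square 0) (P 1 + t • square 1))) ?_ ?_
  · refine (hc.tendsto' 0 z ?_).mono_left nhdsWithin_le_nhds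
    simp only [zero_smul, add_zero]
    exact Prod.ext hα.symm hβ.symm
  · filter_upwards [eventually_noThreeCollinear P] with t ht
    have := ofFoci_mem_genericPairs h₁ h₂ (inv₂ z.1) (inv₂ z.2) ht
    exact this

theorem dense_inv₁_ne_zero : Dense {β : KT | inv₁ β ≠ 0} := by
  intro β
  refine mem_closure_of_tendsto (b := 𝓝[≠] (β 5)) (f := fun t => Function.update β 5 t) ?_ ?_
  · have : Continuous fun t : ℝ => Function.update β 5 t := by fun_prop
    exact (this.tendsto' _ _ (Function.update_eq_self 5 β)).mono_left nhdsWithin_le_nhds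
  · have : ∀ᶠ t in 𝓝[≠] (β 5), t ≠ 0 := by
      by_cases h : β 5 = 0
      · rw [h]
        exact self_mem_nhdsWithin
      · exact nhdsWithin_le_nhds (isOpen_ne.mem_nhds h)
    filter_upwards [this] with t ht
    simpa [inv₁] using ht

theorem dense_genericPairs : Dense genericPairs := by
  have h : {β : KT | inv₁ β ≠ 0} ×ˢ {β : KT | inv₁ β ≠ 0} ⊆ closure genericPairs :=
    fun z hz => mem_closure_genericPairs hz.1 hz.2
  exact dense_closure.mp ((dense_inv₁_ne_zero.prod dense_inv₁_ne_zero).mono h)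

/-! ### Invariance under a uniform neighbourhood of motions. -/

/-- The rigid motion with translation vector `(v.1, v.2.1)` and rotation angle `v.2.2`. -/
noncomputable def SE2.ofAngle (v : ℝ × ℝ × ℝ) : SE2 :=
  ⟨v.1, v.2.1, Real.cos v.2.2, Real.sin v.2.2, Real.cos_sq_add_sin_sq _⟩

theorem SE2.continuous_ofAngle : Continuous SE2.ofAngle := by
  refine continuous_induced_rng.mpr ?_
  simp only [Function.comp_def, SE2.ofAngle]
  fun_prop

theorem SE2.continuous_mul_const (h : SE2) : Continuous fun g : SE2 => g * h := by
  have h1 := SE2.continuous_t₁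
  have h2 := SE2.continuous_t₂
  have h3 := SE2.continuous_c
  have h4 := SE2.continuous_s
  refine continuous_induced_rng.mpr ?_
  change Continuous fun g : SE2 => ((g.c * h.t₁ - g.s * h.t₂ + g.t₁,
    g.s * h.t₁ + g.c * h.t₂ + g.t₂), (g.c * h.c - g.s * h.s, g.s * h.c + g.c * h.s))
  fun_prop

theorem SE2.ofAngle_zero : SE2.ofAngle 0 = 1 := by
  ext
  · rfl
  · rfl
  · exact Real.cos_zero
  · exact Real.sin_zero

/-- A joint invariant is unchanged by all rigid motions in a uniform neighbourhood. -/
theorem IsJointInvariantOn.eventually_eq {V : Set (KT × KT)} (hV : IsOpen V) {J : KT × KT → ℝ}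
    (hJ : IsJointInvariantOn V J) {z₀ : KT × KT} (hz₀ : z₀ ∈ V) :
    ∀ᶠ x in 𝓝 ((0 : ℝ × ℝ × ℝ), z₀), J (jointAct (SE2.ofAngle x.1) x.2) = J x.2 := by
  have hc : Continuous fun x : (ℝ × ℝ × ℝ) × (KT × KT) => jointAct (SE2.ofAngle x.1) x.2 :=
    continuous_jointAct.comp ((SE2.continuous_ofAngle.comp continuous_fst).prodMk continuous_snd)
  have h0 : ∀ᶠ x in 𝓝 ((0 : ℝ × ℝ × ℝ), z₀), jointAct (SE2.ofAngle x.1) x.2 ∈ V := by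
    refine hc.continuousAt.eventually (hV.mem_nhds ?_)
    simpa [SE2.ofAngle_zero, jointAct_one] using hz₀
  obtain ⟨ε, hε, hball⟩ := Metric.eventually_nhds_iff_ball.mp h0
  refine Metric.eventually_nhds_iff_ball.mpr ⟨ε, hε, fun ⟨v, z⟩ hx => ?_⟩
  rw [← ball_prod_same, Set.mem_prod] at hx
  have hm : ∀ u ∈ Metric.ball (0 : ℝ × ℝ × ℝ) ε, jointAct (SE2.ofAngle u) z ∈ V := fun u hu =>
    hball (u, z) (by rw [← ball_prod_same]; exact ⟨hu, hx.2⟩)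
  -- The definition only makes `J` locally constant along the orbit, with no control on the size of
  -- the neighbourhood. The motions with parameters in the ball form a connected family keeping `z`
  -- in `V`, so local constancy gives constancy.
  have key := (convex_ball (0 : ℝ × ℝ × ℝ) ε).isPreconnected.induction₂
    (fun u u' => J (jointAct (SE2.ofAngle u) z) = J (jointAct (SE2.ofAngle u') z))
    (fun u hu => ?_) (fun _ _ _ _ _ _ h h' => h.trans h') (fun _ _ _ _ h => h.symm)
    hx.1 (Metric.mem_ball_self hε)
  · simpa [SE2.ofAngle_zero, jointAct_one] using key
  -- Invariance is applied at the pair already moved by `u`, to the motion that leads from there to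
  -- the pair moved by `u'`.
  · have ht : Tendsto (fun u' => SE2.ofAngle u' * (SE2.ofAngle u)⁻¹)
        (𝓝[Metric.ball 0 ε] u) (𝓝 1) := by
      have := (SE2.continuous_mul_const (SE2.ofAngle u)⁻¹).comp SE2.continuous_ofAngle
      exact (this.tendsto' u 1 (mul_inv_cancel _)).mono_left nhdsWithin_le_nhds
    filter_upwards [ht.eventually (hJ _ (hm u hu)), self_mem_nhdsWithin] with u' h' hu'
    rw [← jointAct_mul, inv_mul_cancel_right] at h'
    exact (h' (hm u' hu')).symm

/-! ### Triangles with prescribed squared sides over a fixed base. -/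

/-- The point with coordinates `x`, `y` with respect to the origin `o` and the orthogonal axes
spanned by `w` and its rotation by a right angle. -/
def framePoint (o w : ℝ × ℝ) (x y : ℝ) : ℝ × ℝ :=
  (o.1 + x * w.1 - y * w.2, o.2 + x * w.2 + y * w.1)

theorem sqDist_framePoint (o w : ℝ × ℝ) (x y x' y' : ℝ) :
    sqDist (framePoint o w x y) (framePoint o w x' y') =
      (w.1 ^ 2 + w.2 ^ 2) * ((x - x') ^ 2 + (y - y') ^ 2) := by
  simp only [sqDist, framePoint]
  ring

/-- First coordinate of the apex of a triangle with base from `0` to `√D` on the first axis, at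
squared distances `a`, `b` from the ends of the base. -/
noncomputable def apexX (a b D : ℝ) : ℝ := (a + D - b) / (2 * Real.sqrt D)

/-- Second coordinate of the apex, on the side of the base given by the sign of `η`. -/
noncomputable def apexY (η a b D : ℝ) : ℝ := η * Real.sqrt ((a - apexX a b D ^ 2) / η ^ 2)

theorem apex_dist {η a b D : ℝ} (hη : η ≠ 0) (hD : 0 < D) (h : 0 < a - apexX a b D ^ 2) :
    apexX a b D ^ 2 + apexY η a b D ^ 2 = a ∧
    (apexX a b D - Real.sqrt D) ^ 2 + apexY η a b D ^ 2 = b := by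
  have hy : apexY η a b D ^ 2 = a - apexX a b D ^ 2 := by
    rw [apexY, mul_pow, Real.sq_sqrt (by positivity)]
    field_simp
  have hs : 0 < Real.sqrt D := Real.sqrt_pos.mpr hD
  have hs2 : Real.sqrt D ^ 2 = D := Real.sq_sqrt hD.le
  have hx : 2 * apexX a b D * Real.sqrt D = a + D - b := by
    unfold apexX
    field_simp
  constructor
  · linarith
  · linear_combination hy - hx + hs2

/-- The height enters as `η` times the root of `(y / η) ^ 2`, so it comes back with its sign when
`y` and `η` lie on the same side of zero. -/
theorem apex_eq {η x y D : ℝ} (hD : 0 < D) (h : 0 < η * y) :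
    apexX (x ^ 2 + y ^ 2) ((x - Real.sqrt D) ^ 2 + y ^ 2) D = x ∧
    apexY η (x ^ 2 + y ^ 2) ((x - Real.sqrt D) ^ 2 + y ^ 2) D = y := by
  have hs : 0 < Real.sqrt D := Real.sqrt_pos.mpr hD
  have hs2 : Real.sqrt D ^ 2 = D := Real.sq_sqrt hD.le
  have hx : apexX (x ^ 2 + y ^ 2) ((x - Real.sqrt D) ^ 2 + y ^ 2) D = x := by
    unfold apexX
    rw [div_eq_iff (by positivity)]
    linear_combination -hs2
  refine ⟨hx, ?_⟩
  have hη : η ≠ 0 := left_ne_zero_of_mul h.ne'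
  rw [apexY, hx, add_sub_cancel_left, ← div_pow, Real.sqrt_sq]
  · field_simp
  · have : y / η = η * y / η ^ 2 := by field_simp
    rw [this]
    positivity

/-- The point at squared distances `a` from `o` and `b` from the point at squared distance `D` from
`o` in the direction `w`. -/
noncomputable def apex (o w : ℝ × ℝ) (η a b D : ℝ) : ℝ × ℝ :=
  framePoint o w
    (apexX (a / (w.1 ^ 2 + w.2 ^ 2)) (b / (w.1 ^ 2 + w.2 ^ 2)) (D / (w.1 ^ 2 + w.2 ^ 2)))
    (apexY η (a / (w.1 ^ 2 + w.2 ^ 2)) (b / (w.1 ^ 2 + w.2 ^ 2)) (D / (w.1 ^ 2 + w.2 ^ 2)))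

/-- The end of the base at squared distance `D` from `o` in the direction `w`. -/
noncomputable def baseEnd (o w : ℝ × ℝ) (D : ℝ) : ℝ × ℝ :=
  framePoint o w (Real.sqrt (D / (w.1 ^ 2 + w.2 ^ 2))) 0

/-- The squared height of the apex in units of the length of `w`. -/
noncomputable def sqHeight (w : ℝ × ℝ) (a b D : ℝ) : ℝ :=
  a / (w.1 ^ 2 + w.2 ^ 2) -
    apexX (a / (w.1 ^ 2 + w.2 ^ 2)) (b / (w.1 ^ 2 + w.2 ^ 2)) (D / (w.1 ^ 2 + w.2 ^ 2)) ^ 2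

theorem framePoint_zero (o w : ℝ × ℝ) : framePoint o w 0 0 = o := by
  simp [framePoint]

theorem sqDist_baseEnd {o w : ℝ × ℝ} {D : ℝ} (hw : 0 < w.1 ^ 2 + w.2 ^ 2) (hD : 0 < D) :
    sqDist o (baseEnd o w D) = D := by
  have h := sqDist_framePoint o w 0 0 (Real.sqrt (D / (w.1 ^ 2 + w.2 ^ 2))) 0
  rw [framePoint_zero] at h
  rw [baseEnd, h]
  have := Real.sq_sqrt (div_pos hD hw).le
  rw [zero_sub, neg_sq, this]
  field_simp
  ring

theorem sqDist_apex {o w : ℝ × ℝ} {η a b D : ℝ} (hw : 0 < w.1 ^ 2 + w.2 ^ 2) (hη : η ≠ 0)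
    (hD : 0 < D) (h : 0 < sqHeight w a b D) :
    sqDist (apex o w η a b D) o = a ∧ sqDist (apex o w η a b D) (baseEnd o w D) = b := by
  obtain ⟨h1, h2⟩ := apex_dist hη (div_pos hD hw) h
  have h0 := fun x y => sqDist_framePoint o w x y 0 0
  simp only [framePoint_zero] at h0
  constructor
  · rw [apex, h0, sub_zero, sub_zero, h1]
    field_simp
  · rw [apex, baseEnd, sqDist_framePoint, sub_zero, h2]
    field_simp

/-! ### The motion that aligns a segment with the fixed base. -/

/-- The cosine of the rotation taking the direction from `q` to `p` to the direction `w`. -/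
noncomputable def alignCos (w q p : ℝ × ℝ) : ℝ :=
  ((p.1 - q.1) * w.1 + (p.2 - q.2) * w.2) /
    ((w.1 ^ 2 + w.2 ^ 2) * Real.sqrt (sqDist q p / (w.1 ^ 2 + w.2 ^ 2)))

/-- The sine of the rotation taking the direction from `q` to `p` to the direction `w`. -/
noncomputable def alignSin (w q p : ℝ × ℝ) : ℝ :=
  ((p.1 - q.1) * w.2 - (p.2 - q.2) * w.1) /
    ((w.1 ^ 2 + w.2 ^ 2) * Real.sqrt (sqDist q p / (w.1 ^ 2 + w.2 ^ 2)))

theorem alignCos_sq_add_alignSin_sq {w q p : ℝ × ℝ} (hw : 0 < w.1 ^ 2 + w.2 ^ 2) (h : q ≠ p) :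
    alignCos w q p ^ 2 + alignSin w q p ^ 2 = 1 := by
  have hD := sqDist_pos h
  have hs := Real.sq_sqrt (div_pos hD hw).le
  unfold alignCos alignSin
  rw [div_pow, div_pow, mul_pow, hs, ← add_div]
  rw [div_eq_one_iff_eq (by positivity)]
  unfold sqDist
  field_simp
  ring

/-- The rigid motion `g` takes `q` to `o` and the direction from `q` to `p` to the direction `w`. -/
structure SE2.Aligns (g : SE2) (o w q p : ℝ × ℝ) : Prop where
  c_eq : g.c = alignCos w q p
  s_eq : g.s = alignSin w q p
  move_eq : g.move q = o

/-- The coordinates of the image in the frame are the inner product and the cross product of `x - q`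
with `p - q`, rescaled by the lengths of `p - q` and `w`. -/
theorem SE2.Aligns.move_eq_framePoint {g : SE2} {o w q p : ℝ × ℝ} (hg : g.Aligns o w q p)
    (x : ℝ × ℝ) : g.move x = framePoint o w
      (((p.1 - q.1) * (x.1 - q.1) + (p.2 - q.2) * (x.2 - q.2)) /
        ((w.1 ^ 2 + w.2 ^ 2) * Real.sqrt (sqDist q p / (w.1 ^ 2 + w.2 ^ 2))))
      (area q p x / ((w.1 ^ 2 + w.2 ^ 2) * Real.sqrt (sqDist q p / (w.1 ^ 2 + w.2 ^ 2)))) := by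
  have h1 := congrArg Prod.fst hg.move_eq
  have h2 := congrArg Prod.snd hg.move_eq
  simp only [SE2.move, hg.c_eq, hg.s_eq] at h1 h2
  simp only [SE2.move, framePoint, hg.c_eq, hg.s_eq]
  rw [← h1, ← h2]
  unfold alignCos alignSin area
  ext <;> simp only <;> ring

theorem SE2.Aligns.baseEnd_eq {g : SE2} {o w q p : ℝ × ℝ} (hg : g.Aligns o w q p)
    (hw : 0 < w.1 ^ 2 + w.2 ^ 2) (h : q ≠ p) : baseEnd o w (sqDist q p) = g.move p := by
  rw [hg.move_eq_framePoint, baseEnd]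
  have hD := sqDist_pos h
  have hs := Real.sq_sqrt (div_pos hD hw).le
  have hs0 := Real.sqrt_pos.mpr (div_pos hD hw)
  have e : (p.1 - q.1) * (p.1 - q.1) + (p.2 - q.2) * (p.2 - q.2) = sqDist q p := by
    unfold sqDist
    ring
  congr 1
  · rw [e, eq_div_iff (by positivity)]
    field_simp at hs
    linear_combination hs
  · have : area q p p = 0 := by unfold area; ring
    rw [this, zero_div]

/-- A triangle over the aligned base is recovered from its squared sides and its orientation, and
rigid motions preserve both. -/
theorem SE2.Aligns.apex_eq {g : SE2} {o w q p x : ℝ × ℝ} {η : ℝ} (hg : g.Aligns o w q p)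
    (hw : 0 < w.1 ^ 2 + w.2 ^ 2) (hx : 0 < η * area q p x) :
    apex o w η (sqDist x q) (sqDist x p) (sqDist q p) = g.move x ∧
    0 < sqHeight w (sqDist x q) (sqDist x p) (sqDist q p) := by
  have h : q ≠ p := by
    rintro rfl
    simp [area] at hx
  have hD := sqDist_pos h
  have hD' := div_pos hD hw
  have hs := Real.sq_sqrt hD'.le
  have hs0 := Real.sqrt_pos.mpr hD'
  set r := Real.sqrt (sqDist q p / (w.1 ^ 2 + w.2 ^ 2)) with hr
  set X := ((p.1 - q.1) * (x.1 - q.1) + (p.2 - q.2) * (x.2 - q.2)) / ((w.1 ^ 2 + w.2 ^ 2) * r)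
    with hX
  set Y := area q p x / ((w.1 ^ 2 + w.2 ^ 2) * r) with hY
  -- Lagrange's identity: the squares of the inner product and of the area add up to the product of
  -- the squared lengths.
  have hXY : sqDist x q / (w.1 ^ 2 + w.2 ^ 2) = X ^ 2 + Y ^ 2 := by
    rw [hX, hY, div_pow, div_pow, mul_pow, hs, ← add_div]
    rw [div_eq_div_iff (by positivity) (by positivity)]
    unfold area sqDist
    field_simp
    ring
  have hXD : 2 * X * r * (w.1 ^ 2 + w.2 ^ 2) =
      2 * ((p.1 - q.1) * (x.1 - q.1) + (p.2 - q.2) * (x.2 - q.2)) := by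
    rw [hX]
    field_simp
  have hXY' : sqDist x p / (w.1 ^ 2 + w.2 ^ 2) = (X - r) ^ 2 + Y ^ 2 := by
    -- The law of cosines.
    have : sqDist x p = sqDist x q + sqDist q p -
        2 * ((p.1 - q.1) * (x.1 - q.1) + (p.2 - q.2) * (x.2 - q.2)) := by
      unfold sqDist
      ring
    rw [this, ← hXD, sub_div, add_div, hXY, ← hs]
    field_simp
    ring
  have hpos : 0 < η * Y := by
    rw [hY, ← mul_div_assoc]
    positivity
  obtain ⟨e1, e2⟩ := KillingE2.apex_eq hD' hpos (x := X)
  rw [hg.move_eq_framePoint, apex, sqHeight, hXY, hXY', e1, e2]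
  refine ⟨rfl, ?_⟩
  have : Y ≠ 0 := right_ne_zero_of_mul hpos.ne'
  rw [add_sub_cancel_left]
  positivity

/-! ### The section: a pair with prescribed invariants. -/

/-- The squared distance of the foci of a Killing tensor with `inv₁ = b` and `inv₃ = c`. -/
noncomputable def focalSqDist (b c : ℝ) : ℝ := 4 * Real.sqrt c / b ^ 2

theorem focalSqDist_eq {β : KT} (h : inv₁ β ≠ 0) {p q : ℝ × ℝ} (hp : IsFocus β p)
    (hq : IsFocus β q) (hpq : p ≠ q) : focalSqDist (inv₁ β) (inv₃ β) = sqDist p q := by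
  have e := eq_ofFoci h hp hq hpq
  have := sqDist_pos hpq
  have e3 : inv₃ β = (inv₁ β ^ 2 * sqDist p q / 4) ^ 2 := by
    conv_lhs => rw [e]
    rw [inv₃_ofFoci]
  rw [focalSqDist, e3, Real.sqrt_sq (by positivity)]
  field_simp

theorem inv₃_ofFoci_of_sqDist {b c m : ℝ} (hb : b ≠ 0) (hc : 0 ≤ c) {p q : ℝ × ℝ}
    (h : sqDist p q = focalSqDist b c) : inv₃ (ofFoci b m p q) = c := by
  rw [inv₃_ofFoci, h, focalSqDist]
  have : b ^ 2 * (4 * Real.sqrt c / b ^ 2) / 4 = Real.sqrt c := by field_simp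
  rw [this, Real.sq_sqrt hc]

/-- Foci with prescribed values `D` of the nine fundamental joint invariants. -/
noncomputable def sectionFoci (o w : ℝ × ℝ) (η₁ η₄ : ℝ) (D : Fin 9 → ℝ) : Fin 4 → ℝ × ℝ :=
  ![apex o w η₁ (focalSqDist (D 3) (D 5)) (D 7) (D 6), o, baseEnd o w (D 6),
    apex o w η₄ (D 8) (focalSqDist (D 0) (D 2)) (D 6)]

/-- A pair with prescribed values `D` of the nine fundamental joint invariants. -/
noncomputable def invSection (o w : ℝ × ℝ) (η₁ η₄ : ℝ) (D : Fin 9 → ℝ) : KT × KT :=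
  (ofFoci (D 0) (D 1) (sectionFoci o w η₁ η₄ D 2) (sectionFoci o w η₁ η₄ D 3),
    ofFoci (D 3) (D 4) (sectionFoci o w η₁ η₄ D 0) (sectionFoci o w η₁ η₄ D 1))

theorem sqDist_comm (p q : ℝ × ℝ) : sqDist p q = sqDist q p := by
  unfold sqDist
  ring

/-- The values `D` from which foci can be reconstructed. -/
structure Admissible (w : ℝ × ℝ) (D : Fin 9 → ℝ) : Prop where
  ne_zero₀ : D 0 ≠ 0
  ne_zero₃ : D 3 ≠ 0
  pos₂ : 0 < D 2
  pos₅ : 0 < D 5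
  pos₆ : 0 < D 6
  pos₁ : 0 < sqHeight w (focalSqDist (D 3) (D 5)) (D 7) (D 6)
  pos₄ : 0 < sqHeight w (D 8) (focalSqDist (D 0) (D 2)) (D 6)

theorem focalSqDist_pos {b c : ℝ} (hb : b ≠ 0) (hc : 0 < c) : 0 < focalSqDist b c := by
  have := Real.sqrt_pos.mpr hc
  unfold focalSqDist
  positivity

theorem ne_of_sqDist_pos {p q : ℝ × ℝ} (h : 0 < sqDist p q) : p ≠ q := by
  rintro rfl
  simp [sqDist] at h

section reconstruction

variable {o w : ℝ × ℝ} {η₁ η₄ : ℝ} {D : Fin 9 → ℝ}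

theorem Admissible.sqDist_sectionFoci (hD : Admissible w D) (hw : 0 < w.1 ^ 2 + w.2 ^ 2)
    (h₁ : η₁ ≠ 0) (h₄ : η₄ ≠ 0) :
    sqDist (sectionFoci o w η₁ η₄ D 0) (sectionFoci o w η₁ η₄ D 1) = focalSqDist (D 3) (D 5) ∧
    sqDist (sectionFoci o w η₁ η₄ D 2) (sectionFoci o w η₁ η₄ D 3) = focalSqDist (D 0) (D 2) ∧
    sqDist (sectionFoci o w η₁ η₄ D 1) (sectionFoci o w η₁ η₄ D 2) = D 6 ∧
    sqDist (sectionFoci o w η₁ η₄ D 0) (sectionFoci o w η₁ η₄ D 2) = D 7 ∧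
    sqDist (sectionFoci o w η₁ η₄ D 1) (sectionFoci o w η₁ η₄ D 3) = D 8 := by
  have a1 := sqDist_apex (o := o) hw h₁ hD.pos₆ hD.pos₁
  have a4 := sqDist_apex (o := o) hw h₄ hD.pos₆ hD.pos₄
  exact ⟨a1.1, (sqDist_comm _ _).trans a4.2, sqDist_baseEnd hw hD.pos₆, a1.2,
    (sqDist_comm _ _).trans a4.1⟩

theorem Admissible.isFociLabelling (hD : Admissible w D) (hw : 0 < w.1 ^ 2 + w.2 ^ 2)
    (h₁ : η₁ ≠ 0) (h₄ : η₄ ≠ 0) :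
    IsFociLabelling (invSection o w η₁ η₄ D) (sectionFoci o w η₁ η₄ D) := by
  obtain ⟨d1, d2, -⟩ := hD.sqDist_sectionFoci (o := o) hw h₁ h₄
  exact isFociLabelling_ofFoci _ _ _ _
    (ne_of_sqDist_pos (d1 ▸ focalSqDist_pos hD.ne_zero₃ hD.pos₅))
    (ne_of_sqDist_pos (d2 ▸ focalSqDist_pos hD.ne_zero₀ hD.pos₂))

theorem Admissible.fundInv_invSection (hD : Admissible w D) (hw : 0 < w.1 ^ 2 + w.2 ^ 2)
    (h₁ : η₁ ≠ 0) (h₄ : η₄ ≠ 0) {F : KT × KT → Fin 4 → ℝ × ℝ}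
    (hF : F (invSection o w η₁ η₄ D) = sectionFoci o w η₁ η₄ D) :
    fundInv F (invSection o w η₁ η₄ D) = D := by
  obtain ⟨d1, d2, d3, d4, d5⟩ := hD.sqDist_sectionFoci (o := o) hw h₁ h₄
  simp only [fundInv, hF, d3, d4, d5]
  simp only [invSection, inv₁_ofFoci, inv₂_ofFoci hD.ne_zero₀, inv₂_ofFoci hD.ne_zero₃,
    inv₃_ofFoci_of_sqDist hD.ne_zero₀ hD.pos₂.le d2,
    inv₃_ofFoci_of_sqDist hD.ne_zero₃ hD.pos₅.le d1]
  funext i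
  fin_cases i <;> rfl

end reconstruction

section normalization

variable {o w : ℝ × ℝ} {η₁ η₄ : ℝ} {F : KT × KT → Fin 4 → ℝ × ℝ} {z : KT × KT} {g : SE2}

theorem SE2.Aligns.sectionFoci_fundInv (hz : IsFociLabelling z (F z)) (hz₁ : NonDegenerate z.1)
    (hz₂ : NonDegenerate z.2) (hw : 0 < w.1 ^ 2 + w.2 ^ 2)
    (hg : g.Aligns o w (F z 1) (F z 2)) (h₁ : 0 < η₁ * area (F z 1) (F z 2) (F z 0))
    (h₄ : 0 < η₄ * area (F z 1) (F z 2) (F z 3)) :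
    sectionFoci o w η₁ η₄ (fundInv F z) = (fun i => g.move (F z i)) ∧
      Admissible w (fundInv F z) := by
  have hn : F z 1 ≠ F z 2 := by
    intro h
    rw [h] at h₁
    simp [area] at h₁
  obtain ⟨p0, p1, p01, p2, p3, p23⟩ := hz
  have e₁ : focalSqDist (fundInv F z 3) (fundInv F z 5) = sqDist (F z 0) (F z 1) :=
    focalSqDist_eq hz₂.1 p0 p1 p01
  have e₄ : focalSqDist (fundInv F z 0) (fundInv F z 2) = sqDist (F z 3) (F z 2) :=
    focalSqDist_eq hz₁.1 p3 p2 p23.symm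
  have e₆ : fundInv F z 6 = sqDist (F z 1) (F z 2) := rfl
  have e₇ : fundInv F z 7 = sqDist (F z 0) (F z 2) := rfl
  have e₈ : fundInv F z 8 = sqDist (F z 3) (F z 1) := sqDist_comm _ _
  obtain ⟨a1, b1⟩ := hg.apex_eq hw h₁
  obtain ⟨a4, b4⟩ := hg.apex_eq hw h₄
  constructor
  · funext i
    rw [sectionFoci, e₁, e₄, e₆, e₇, e₈, a1, a4, hg.baseEnd_eq hw hn]
    fin_cases i
    · rfl
    · exact hg.move_eq.symm
    · rfl
    · rfl
  · refine ⟨hz₁.1, hz₂.1, ?_, ?_, ?_, ?_, ?_⟩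
    · exact lt_of_le_of_ne (inv₃_nonneg _) ((nonDegenerate_iff _).mp hz₁).2.symm
    · exact lt_of_le_of_ne (inv₃_nonneg _) ((nonDegenerate_iff _).mp hz₂).2.symm
    · exact sqDist_pos hn
    · rwa [e₁, e₆, e₇]
    · rwa [e₄, e₆, e₈]

/-- The section picks the aligned representative of the orbit: the foci are reconstructed in aligned
position, and the tensors are determined by them together with `inv₁` and `inv₂`. -/
theorem SE2.Aligns.invSection_fundInv (hz : IsFociLabelling z (F z)) (hz₁ : NonDegenerate z.1)
    (hz₂ : NonDegenerate z.2) (hw : 0 < w.1 ^ 2 + w.2 ^ 2)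
    (hg : g.Aligns o w (F z 1) (F z 2)) (h₁ : 0 < η₁ * area (F z 1) (F z 2) (F z 0))
    (h₄ : 0 < η₄ * area (F z 1) (F z 2) (F z 3)) :
    invSection o w η₁ η₄ (fundInv F z) = jointAct g z := by
  rw [invSection, (hg.sectionFoci_fundInv hz hz₁ hz₂ hw h₁ h₄).1]
  simp only [← act_ofFoci]
  obtain ⟨p0, p1, p01, p2, p3, p23⟩ := hz
  exact Prod.ext (congrArg (act g) (eq_ofFoci hz₁.1 p2 p3 p23).symm)
    (congrArg (act g) (eq_ofFoci hz₂.1 p0 p1 p01).symm)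

end normalization

/-! ### Analyticity of the section. -/

section analyticity

variable {E : Type*} [NormedAddCommGroup E] [NormedSpace ℝ E] {x : E}

theorem analyticAt_sqrt {f : E → ℝ} (hf : AnalyticAt ℝ f x) (h : f x ≠ 0) :
    AnalyticAt ℝ (fun y => Real.sqrt (f y)) x :=
  (hf.contDiffAt.sqrt h).analyticAt

theorem analyticAt_apexX {a b d : E → ℝ} (ha : AnalyticAt ℝ a x) (hb : AnalyticAt ℝ b x)
    (hd : AnalyticAt ℝ d x) (h : 0 < d x) : AnalyticAt ℝ (fun y => apexX (a y) (b y) (d y)) x := by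
  unfold apexX
  have := Real.sqrt_pos.mpr h
  exact ((ha.add hd).sub hb).div (analyticAt_const.mul (analyticAt_sqrt hd h.ne'))
    (by positivity)

theorem analyticAt_div_const {f : E → ℝ} (hf : AnalyticAt ℝ f x) (c : ℝ) :
    AnalyticAt ℝ (fun y => f y / c) x := by
  simp only [div_eq_mul_inv]
  exact hf.mul analyticAt_const

theorem analyticAt_framePoint (o w : ℝ × ℝ) {f g : E → ℝ} (hf : AnalyticAt ℝ f x)
    (hg : AnalyticAt ℝ g x) : AnalyticAt ℝ (fun y => framePoint o w (f y) (g y)) x := by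
  unfold framePoint
  exact ((analyticAt_const.add (hf.mul analyticAt_const)).sub (hg.mul analyticAt_const)).prod
    ((analyticAt_const.add (hf.mul analyticAt_const)).add (hg.mul analyticAt_const))

theorem analyticAt_baseEnd (o : ℝ × ℝ) {w : ℝ × ℝ} (hw : 0 < w.1 ^ 2 + w.2 ^ 2) {d : E → ℝ}
    (hd : AnalyticAt ℝ d x) (h : 0 < d x) : AnalyticAt ℝ (fun y => baseEnd o w (d y)) x :=
  analyticAt_framePoint o w (analyticAt_sqrt (analyticAt_div_const hd _) (div_pos h hw).ne')
    analyticAt_const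

theorem analyticAt_sqHeight {w : ℝ × ℝ} (hw : 0 < w.1 ^ 2 + w.2 ^ 2) {a b d : E → ℝ}
    (ha : AnalyticAt ℝ a x) (hb : AnalyticAt ℝ b x) (hd : AnalyticAt ℝ d x) (h : 0 < d x) :
    AnalyticAt ℝ (fun y => sqHeight w (a y) (b y) (d y)) x :=
  (analyticAt_div_const ha _).sub ((analyticAt_apexX (analyticAt_div_const ha _)
    (analyticAt_div_const hb _) (analyticAt_div_const hd _) (div_pos h hw)).pow 2)

theorem analyticAt_apex (o : ℝ × ℝ) {w : ℝ × ℝ} (hw : 0 < w.1 ^ 2 + w.2 ^ 2) {η : ℝ}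
    (hη : η ≠ 0) {a b d : E → ℝ} (ha : AnalyticAt ℝ a x) (hb : AnalyticAt ℝ b x)
    (hd : AnalyticAt ℝ d x) (h : 0 < d x) (hh : 0 < sqHeight w (a x) (b x) (d x)) :
    AnalyticAt ℝ (fun y => apex o w η (a y) (b y) (d y)) x := by
  refine analyticAt_framePoint o w (analyticAt_apexX (analyticAt_div_const ha _)
    (analyticAt_div_const hb _) (analyticAt_div_const hd _) (div_pos h hw)) ?_
  refine analyticAt_const.mul (analyticAt_sqrt
    (analyticAt_div_const (analyticAt_sqHeight hw ha hb hd h) _) ?_)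
  have : 0 < η ^ 2 := by positivity
  exact (div_pos hh this).ne'

theorem analyticAt_focalSqDist {b c : E → ℝ} (hb : AnalyticAt ℝ b x) (hc : AnalyticAt ℝ c x)
    (h : b x ≠ 0) (h' : c x ≠ 0) : AnalyticAt ℝ (fun y => focalSqDist (b y) (c y)) x :=
  (analyticAt_const.mul (analyticAt_sqrt hc h')).div (hb.pow 2) (pow_ne_zero 2 h)

theorem analyticAt_ofFoci {b m : E → ℝ} {p q : E → ℝ × ℝ} (hb : AnalyticAt ℝ b x)
    (hm : AnalyticAt ℝ m x) (hp : AnalyticAt ℝ p x) (hq : AnalyticAt ℝ q x) (h : b x ≠ 0) :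
    AnalyticAt ℝ (fun y => ofFoci (b y) (m y) (p y) (q y)) x := by
  have hp1 : AnalyticAt ℝ (fun y => (p y).1) x := analyticAt_fst.comp hp
  have hp2 : AnalyticAt ℝ (fun y => (p y).2) x := analyticAt_snd.comp hp
  have hq1 : AnalyticAt ℝ (fun y => (q y).1) x := analyticAt_fst.comp hq
  have hq2 : AnalyticAt ℝ (fun y => (q y).2) x := analyticAt_snd.comp hq
  have hs := (hm.div hb h).add
    (analyticAt_div_const (hb.mul (((hp1.add hq1).pow 2).add ((hp2.add hq2).pow 2))) 4)
  have ht := hb.mul ((hp1.mul hq1).sub (hp2.mul hq2))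
  refine AnalyticAt.pi fun i => ?_
  fin_cases i
  · exact analyticAt_div_const (hs.sub ht) 2
  · exact analyticAt_div_const (hs.add ht) 2
  · exact analyticAt_div_const (hb.neg.mul ((hp1.mul hq2).add (hq1.mul hp2))) 2
  · exact analyticAt_div_const (hb.neg.mul (hp2.add hq2)) 2
  · exact analyticAt_div_const (hb.neg.mul (hp1.add hq1)) 2
  · exact hb

end analyticity

theorem analyticAt_proj (i : Fin 9) (D : Fin 9 → ℝ) : AnalyticAt ℝ (fun D : Fin 9 → ℝ => D i) D :=
  (ContinuousLinearMap.proj (R := ℝ) (φ := fun _ : Fin 9 => ℝ) i).analyticAt D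

section section_analytic

variable {w : ℝ × ℝ} {D : Fin 9 → ℝ}

theorem Admissible.analyticAt_sectionFoci (hD : Admissible w D) (hw : 0 < w.1 ^ 2 + w.2 ^ 2)
    (o : ℝ × ℝ) {η₁ η₄ : ℝ} (h₁ : η₁ ≠ 0) (h₄ : η₄ ≠ 0) :
    AnalyticAt ℝ (sectionFoci o w η₁ η₄) D := by
  have hp := fun i => analyticAt_proj i D
  have f₁ := analyticAt_focalSqDist (hp 3) (hp 5) hD.ne_zero₃ hD.pos₅.ne'
  have f₄ := analyticAt_focalSqDist (hp 0) (hp 2) hD.ne_zero₀ hD.pos₂.ne'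
  refine AnalyticAt.pi fun i => ?_
  fin_cases i
  · exact analyticAt_apex o hw h₁ f₁ (hp 7) (hp 6) hD.pos₆ hD.pos₁
  · exact analyticAt_const
  · exact analyticAt_baseEnd o hw (hp 6) hD.pos₆
  · exact analyticAt_apex o hw h₄ (hp 8) f₄ (hp 6) hD.pos₆ hD.pos₄

theorem Admissible.analyticAt_invSection (hD : Admissible w D) (hw : 0 < w.1 ^ 2 + w.2 ^ 2)
    (o : ℝ × ℝ) {η₁ η₄ : ℝ} (h₁ : η₁ ≠ 0) (h₄ : η₄ ≠ 0) :
    AnalyticAt ℝ (invSection o w η₁ η₄) D := by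
  have hs := analyticAt_pi_iff.mp (hD.analyticAt_sectionFoci hw o h₁ h₄)
  exact (analyticAt_ofFoci (analyticAt_proj 0 D) (analyticAt_proj 1 D) (hs 2) (hs 3)
    hD.ne_zero₀).prod
    (analyticAt_ofFoci (analyticAt_proj 3 D) (analyticAt_proj 4 D) (hs 0) (hs 1) hD.ne_zero₃)

theorem Admissible.eventually (hD : Admissible w D) (hw : 0 < w.1 ^ 2 + w.2 ^ 2) :
    ∀ᶠ D' in 𝓝 D, Admissible w D' := by
  have hp := fun i => analyticAt_proj i D
  have f₁ := analyticAt_focalSqDist (hp 3) (hp 5) hD.ne_zero₃ hD.pos₅.ne'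
  have f₄ := analyticAt_focalSqDist (hp 0) (hp 2) hD.ne_zero₀ hD.pos₂.ne'
  have s₁ := analyticAt_sqHeight hw f₁ (hp 7) (hp 6) hD.pos₆
  have s₄ := analyticAt_sqHeight hw (hp 8) f₄ (hp 6) hD.pos₆
  filter_upwards [(hp 0).continuousAt.eventually_ne hD.ne_zero₀,
    (hp 3).continuousAt.eventually_ne hD.ne_zero₃,
    (hp 2).continuousAt.eventually (lt_mem_nhds hD.pos₂),
    (hp 5).continuousAt.eventually (lt_mem_nhds hD.pos₅),
    (hp 6).continuousAt.eventually (lt_mem_nhds hD.pos₆),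
    s₁.continuousAt.eventually (lt_mem_nhds hD.pos₁),
    s₄.continuousAt.eventually (lt_mem_nhds hD.pos₄)] with D' a b c d e f g
  exact ⟨a, b, c, d, e, f, g⟩

end section_analytic

/-! ### The local section and the aligning motion near a given pair. -/

theorem alignCos_self {q p : ℝ × ℝ} (h : q ≠ p) : alignCos (p - q) q p = 1 := by
  have hD := sqDist_pos h
  have : (p - q).1 ^ 2 + (p - q).2 ^ 2 = sqDist q p := by
    simp only [Prod.fst_sub, Prod.snd_sub, sqDist]
    ring
  rw [alignCos, this, div_self hD.ne', Real.sqrt_one, mul_one, div_eq_one_iff_eq hD.ne']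
  simp only [Prod.fst_sub, Prod.snd_sub, sqDist]
  ring

theorem alignSin_self (q p : ℝ × ℝ) : alignSin (p - q) q p = 0 := by
  rw [alignSin, div_eq_zero_iff]
  left
  simp only [Prod.fst_sub, Prod.snd_sub]
  ring

/-- Translation vector and rotation angle of the rigid motion taking `q` to `o` and the direction
from `q` to `p` to the direction `w`, when the rotation angle is acute. -/
noncomputable def alignParams (o w q p : ℝ × ℝ) : ℝ × ℝ × ℝ :=
  (o.1 - (alignCos w q p * q.1 - alignSin w q p * q.2),
    o.2 - (alignSin w q p * q.1 + alignCos w q p * q.2), Real.arcsin (alignSin w q p))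

/-- With a positive cosine, the arcsine of the sine is the rotation angle itself; this provides a
parameter depending continuously on the points. -/
theorem aligns_ofAngle (o : ℝ × ℝ) {w q p : ℝ × ℝ} (hw : 0 < w.1 ^ 2 + w.2 ^ 2) (h : q ≠ p)
    (hc : 0 < alignCos w q p) : (SE2.ofAngle (alignParams o w q p)).Aligns o w q p := by
  have h1 := alignCos_sq_add_alignSin_sq hw h
  have hsin : Real.sin (Real.arcsin (alignSin w q p)) = alignSin w q p :=
    Real.sin_arcsin (by nlinarith) (by nlinarith)
  have hcos : Real.cos (Real.arcsin (alignSin w q p)) = alignCos w q p := by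
    rw [Real.cos_arcsin, ← h1, add_sub_cancel_right, Real.sqrt_sq hc.le]
  refine ⟨hcos, hsin, ?_⟩
  simp only [SE2.move, SE2.ofAngle, alignParams, hsin, hcos]
  ext <;> simp only <;> ring

theorem alignParams_self {q p : ℝ × ℝ} (h : q ≠ p) : alignParams q (p - q) q p = 0 := by
  simp [alignParams, alignCos_self h, alignSin_self]

theorem continuousAt_align {X : Type*} [TopologicalSpace X] {x : X} (o : ℝ × ℝ) {w : ℝ × ℝ}
    (hw : 0 < w.1 ^ 2 + w.2 ^ 2) {q p : X → ℝ × ℝ} (hq : ContinuousAt q x)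
    (hp : ContinuousAt p x) (h : q x ≠ p x) :
    ContinuousAt (fun y => alignCos w (q y) (p y)) x ∧
      ContinuousAt (fun y => alignParams o w (q y) (p y)) x := by
  have hD := div_pos (sqDist_pos h) hw
  have hn : (w.1 ^ 2 + w.2 ^ 2) * Real.sqrt (sqDist (q x) (p x) / (w.1 ^ 2 + w.2 ^ 2)) ≠ 0 :=
    mul_ne_zero hw.ne' (Real.sqrt_pos.mpr hD).ne'
  have hr : ContinuousAt (fun y => (w.1 ^ 2 + w.2 ^ 2) *
      Real.sqrt (sqDist (q y) (p y) / (w.1 ^ 2 + w.2 ^ 2))) x := by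
    unfold sqDist
    fun_prop
  have hc : ContinuousAt (fun y => alignCos w (q y) (p y)) x :=
    ContinuousAt.div (by fun_prop) hr hn
  have hs : ContinuousAt (fun y => alignSin w (q y) (p y)) x :=
    ContinuousAt.div (by fun_prop) hr hn
  refine ⟨hc, ?_⟩
  have ha : ContinuousAt (fun y => Real.arcsin (alignSin w (q y) (p y))) x :=
    Real.continuous_arcsin.continuousAt.comp hs
  unfold alignParams
  fun_prop

/-- Near a pair in general position the fundamental invariants have an analytic section through
that pair, and small rigid motions take nearby pairs into the section. -/
theorem IsFociBranch.exists_section {W : Set (KT × KT)} {F : KT × KT → Fin 4 → ℝ × ℝ}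
    (hF : IsFociBranch W F) {z₀ : KT × KT} (hz₀ : z₀ ∈ W) (hg : GeneralPosition (F z₀)) :
    ∃ (S : (Fin 9 → ℝ) → KT × KT) (v : KT × KT → ℝ × ℝ × ℝ),
      AnalyticAt ℝ S (fundInv F z₀) ∧ S (fundInv F z₀) = z₀ ∧
      (∀ᶠ D in 𝓝 (fundInv F z₀), fundInv F (S D) = D) ∧
      ContinuousAt v z₀ ∧ v z₀ = 0 ∧
      ∀ᶠ z in 𝓝 z₀, S (fundInv F z) = jointAct (SE2.ofAngle (v z)) z := by
  rw [generalPosition_iff] at hg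
  obtain ⟨n1, n2⟩ := hF.nonDegenerate z₀ hz₀
  have hl := hF.labelling z₀ hz₀
  have hc := hF.continuousOn.continuousAt (hF.isOpen.mem_nhds hz₀)
  have hci : ∀ i, ContinuousAt (fun z => F z i) z₀ := fun i => continuousAt_pi.mp hc i
  have h₁ : area (F z₀ 1) (F z₀ 2) (F z₀ 0) ≠ 0 := by
    rw [area_swap_right, area_swap_left, neg_neg]
    exact hg.1
  have h₄ : area (F z₀ 1) (F z₀ 2) (F z₀ 3) ≠ 0 := hg.2
  have hne : F z₀ 1 ≠ F z₀ 2 := fun h => by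
    rw [h] at h₄
    simp [area] at h₄
  -- The frame and the orientations are read off from `z₀` itself, so the aligning motion is the
  -- identity at `z₀` and the section passes through `z₀`.
  set o := F z₀ 1 with ho
  set w := F z₀ 2 - o with hwdef
  set η₁ := area o (F z₀ 2) (F z₀ 0) with hη₁
  set η₄ := area o (F z₀ 2) (F z₀ 3) with hη₄
  have hw : 0 < w.1 ^ 2 + w.2 ^ 2 := by
    have := sqDist_pos hne.symm
    simpa [hwdef, sqDist] using this
  have hcos0 : alignCos w (F z₀ 1) (F z₀ 2) = 1 := alignCos_self hne
  have hv0 : alignParams o w (F z₀ 1) (F z₀ 2) = 0 := alignParams_self hne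
  obtain ⟨c1, c2⟩ := continuousAt_align o hw (hci 1) (hci 2) hne
  have ha : ∀ i, ContinuousAt (fun z => area (F z 1) (F z 2) (F z i)) z₀ := fun i => by
    have a1 := hci 1
    have a2 := hci 2
    have a3 := hci i
    unfold area
    fun_prop
  have hal : ∀ᶠ z in 𝓝 z₀, z ∈ W ∧ 0 < η₁ * area (F z 1) (F z 2) (F z 0) ∧
      0 < η₄ * area (F z 1) (F z 2) (F z 3) ∧
      (SE2.ofAngle (alignParams o w (F z 1) (F z 2))).Aligns o w (F z 1) (F z 2) := by
    have e0 : ∀ᶠ z in 𝓝 z₀, 0 < η₁ * area (F z 1) (F z 2) (F z 0) :=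
      (continuousAt_const.mul (ha 0)).eventually
        (lt_mem_nhds (mul_self_pos.mpr h₁))
    have e3 : ∀ᶠ z in 𝓝 z₀, 0 < η₄ * area (F z 1) (F z 2) (F z 3) :=
      (continuousAt_const.mul (ha 3)).eventually
        (lt_mem_nhds (mul_self_pos.mpr h₄))
    have ec : ∀ᶠ z in 𝓝 z₀, 0 < alignCos w (F z 1) (F z 2) :=
      c1.eventually (lt_mem_nhds (one_pos.trans_eq hcos0.symm))
    filter_upwards [hF.isOpen.mem_nhds hz₀, e0, e3, ec,
      eventually_ne_of_tendsto (hci 1) (hci 2) hne] with z b0 b1 b2 b3 b4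
    exact ⟨b0, b1, b2, aligns_ofAngle o hw b4 b3⟩
  obtain ⟨-, a0, a3, hal0⟩ := hal.self_of_nhds
  have hS : ∀ᶠ z in 𝓝 z₀, invSection o w η₁ η₄ (fundInv F z) =
      jointAct (SE2.ofAngle (alignParams o w (F z 1) (F z 2))) z := by
    filter_upwards [hal] with z hz
    exact hz.2.2.2.invSection_fundInv (hF.labelling z hz.1) (hF.nonDegenerate z hz.1).1
      (hF.nonDegenerate z hz.1).2 hw hz.2.1 hz.2.2.1
  obtain ⟨hs0, hadm⟩ := hal0.sectionFoci_fundInv hl n1 n2 hw a0 a3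
  have hS0 := hS.self_of_nhds
  rw [hv0, SE2.ofAngle_zero] at hs0 hS0
  rw [jointAct_one] at hS0
  simp only [SE2.move_one] at hs0
  have hSa := hadm.analyticAt_invSection hw o h₁ h₄
  refine ⟨invSection o w η₁ η₄, fun z => alignParams o w (F z 1) (F z 2), hSa, hS0, ?_, c2, hv0,
    hS⟩
  have hadm' := hadm.eventually hw
  have t1 : Tendsto (invSection o w η₁ η₄) (𝓝 (fundInv F z₀)) (𝓝 z₀) := by
    have := hSa.continuousAt.tendsto
    rwa [hS0] at this
  have t2 : Tendsto (sectionFoci o w η₁ η₄) (𝓝 (fundInv F z₀)) (𝓝 (F z₀)) := by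
    have := (hadm.analyticAt_sectionFoci hw o h₁ h₄).continuousAt.tendsto
    rwa [hs0] at this
  -- The reconstructed foci label the reconstructed pair and tend to `F z₀`, so they are the labels
  -- chosen by `F`; only then are the last three invariants of that pair the prescribed ones.
  filter_upwards [hadm', hF.eventually_eq hz₀ t1 t2
    (hadm'.mono fun D hD => hD.isFociLabelling hw h₁ h₄)] with D hD hFD
  exact hD.fundInv_invSection hw h₁ h₄ hFD

/-! ### Independence of the differentials and factorisation of joint invariants. -/

/-- Functions with a differentiable local section have independent differentials. -/
theorem linearIndependent_fderiv_of_section {ι E : Type*} [Fintype ι] [NormedAddCommGroup E]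
    [NormedSpace ℝ E] {f : E → ι → ℝ} {S : (ι → ℝ) → E} {x : E}
    (hf : ∀ i, DifferentiableAt ℝ (fun y => f y i) x) (hS : DifferentiableAt ℝ S (f x))
    (h0 : S (f x) = x) (h : ∀ᶠ D in 𝓝 (f x), f (S D) = D) :
    LinearIndependent ℝ (fun i => fderiv ℝ (fun y => f y i) x) := by
  have key : ∀ i, (fderiv ℝ (fun y => f y i) x).comp (fderiv ℝ S (f x)) =
      ContinuousLinearMap.proj (R := ℝ) (φ := fun _ : ι => ℝ) i := by
    intro i
    have h1 : HasFDerivAt (fun y => f y i) (fderiv ℝ (fun y => f y i) x) (S (f x)) := by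
      rw [h0]
      exact (hf i).hasFDerivAt
    have h2 := h1.comp (f x) hS.hasFDerivAt
    refine h2.unique (HasFDerivAt.congr_of_eventuallyEq
      (ContinuousLinearMap.proj (R := ℝ) (φ := fun _ : ι => ℝ) i).hasFDerivAt ?_)
    filter_upwards [h] with D hD
    exact congrFun hD i
  classical
  rw [Fintype.linearIndependent_iff]
  intro c hc j
  -- The image of the `j`-th unit vector under the derivative of `S` is dual to the differentials,
  -- so evaluating the relation there isolates `c j`.
  have h3 := congrArg (fun L : E →L[ℝ] ℝ => L (fderiv ℝ S (f x) (Pi.single j 1))) hc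
  simp only [sum_apply, smul_apply, zero_apply] at h3
  have h4 : ∀ i, fderiv ℝ (fun y => f y i) x (fderiv ℝ S (f x) (Pi.single j 1)) =
      (Pi.single j 1 : ι → ℝ) i := fun i => congrArg (fun L => L (Pi.single j 1)) (key i)
  simpa [h4, Pi.single_apply] using h3

theorem IsFociBranch.linearIndependent_fderiv {W : Set (KT × KT)}
    {F : KT × KT → Fin 4 → ℝ × ℝ} (hF : IsFociBranch W F) {z₀ : KT × KT} (hz₀ : z₀ ∈ W)
    (hg : GeneralPosition (F z₀)) :
    LinearIndependent ℝ (fun i : Fin 9 => fderiv ℝ (fun z => fundInv F z i) z₀) := by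
  obtain ⟨S, v, hS, hS0, hSD, -⟩ := hF.exists_section hz₀ hg
  exact linearIndependent_fderiv_of_section
    (fun i => (hF.analyticAt_fundInv hz₀ i).differentiableAt) hS.differentiableAt hS0 hSD

/-- With `S` the local section, `Φ` is `J ∘ S`: near `z₀` the point `S (fundInv F z)` is `z` moved
by a small motion, which leaves `J` unchanged. -/
theorem IsFociBranch.exists_eq_comp_fundInv {W : Set (KT × KT)}
    {F : KT × KT → Fin 4 → ℝ × ℝ} (hF : IsFociBranch W F) {z₀ : KT × KT} (hz₀ : z₀ ∈ W)
    (hg : GeneralPosition (F z₀)) {V : Set (KT × KT)} (hV : IsOpen V) (hzV : z₀ ∈ V)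
    {J : KT × KT → ℝ} (hJ : IsJointInvariantOn V J) :
    ∃ (V' : Set (KT × KT)) (O : Set (Fin 9 → ℝ)) (Φ : (Fin 9 → ℝ) → ℝ),
      IsOpen V' ∧ z₀ ∈ V' ∧ V' ⊆ V ∧ V' ⊆ W ∧ IsOpen O ∧
      (∀ z ∈ V', fundInv F z ∈ O ∧ J z = Φ (fundInv F z)) ∧
      ∀ n : WithTop ℕ∞, ContDiffOn ℝ n J V → ContDiffOn ℝ n Φ O := by
  obtain ⟨S, v, hS, hS0, -, hv, hv0, hSv⟩ := hF.exists_section hz₀ hg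
  have hSV : ∀ᶠ D in 𝓝 (fundInv F z₀), S D ∈ V :=
    hS.continuousAt.eventually (hV.mem_nhds (by rwa [hS0]))
  -- On `O` the section is analytic and has values in `V`, so one choice of `O` and `Φ` serves every
  -- class `n`, including the analytic one.
  obtain ⟨O, hO, hOo, hzO⟩ := eventually_nhds_iff.mp (hS.eventually_analyticAt.and hSV)
  have hc : ContinuousAt (fundInv F) z₀ :=
    continuousAt_pi.mpr fun i => (hF.analyticAt_fundInv hz₀ i).continuousAt
  have hJv : ∀ᶠ z in 𝓝 z₀, J (jointAct (SE2.ofAngle (v z)) z) = J z := by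
    have ht : Tendsto (fun z => (v z, z)) (𝓝 z₀) (𝓝 ((0 : ℝ × ℝ × ℝ), z₀)) := by
      rw [← hv0]
      exact hv.tendsto.prodMk_nhds tendsto_id
    -- The motion varies with `z`, which is why the uniform form of invariance is needed.
    exact ht.eventually (hJ.eventually_eq hV hzV)
  obtain ⟨V', hV', hVo, hz'⟩ := eventually_nhds_iff.mp
    ((hV.eventually_mem hzV).and ((hF.isOpen.eventually_mem hz₀).and
      ((hc.eventually (hOo.mem_nhds hzO)).and (hSv.and hJv))))
  refine ⟨V', O, J ∘ S, hVo, hz', fun z hz => (hV' z hz).1, fun z hz => (hV' z hz).2.1, hOo,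
    fun z hz => ?_, fun n hn => ?_⟩
  · obtain ⟨-, -, h1, h2, h3⟩ := hV' z hz
    exact ⟨h1, by rw [Function.comp_apply, h2, h3]⟩
  · exact hn.comp (fun D hD => (hO D hD).1.contDiffAt.contDiffWithinAt) fun D hD => (hO D hD).2

end KillingE2

theorem theorem4p1 :
    -- Each non-degenerate Killing tensor has exactly two foci, and labelled foci of a pair extend
    -- continuously to nearby pairs.
    (∀ β : KillingE2.KT, KillingE2.NonDegenerate β →
      {p : ℝ × ℝ | KillingE2.IsFocus β p}.ncard = 2) ∧
    (∀ z₀ : KillingE2.KT × KillingE2.KT,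
      KillingE2.NonDegenerate z₀.1 → KillingE2.NonDegenerate z₀.2 →
      ∀ p : Fin 4 → ℝ × ℝ, KillingE2.IsFociLabelling z₀ p →
        ∃ (W : Set (KillingE2.KT × KillingE2.KT))
          (F : KillingE2.KT × KillingE2.KT → Fin 4 → ℝ × ℝ),
          KillingE2.IsFociBranch W F ∧ z₀ ∈ W ∧ F z₀ = p) ∧
    -- The six single-copy invariants are invariant under all of `SE(2)`.
    (∀ (g : KillingE2.SE2) (β : KillingE2.KT),
      KillingE2.inv₁ (KillingE2.act g β) = KillingE2.inv₁ β ∧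
      KillingE2.inv₂ (KillingE2.act g β) = KillingE2.inv₂ β ∧
      KillingE2.inv₃ (KillingE2.act g β) = KillingE2.inv₃ β) ∧
    -- Generic pairs form an open dense set.
    (IsOpen KillingE2.genericPairs ∧ Dense KillingE2.genericPairs) ∧
    -- The nine functions are analytic joint invariants wherever the foci are labelled.
    (∀ (W : Set (KillingE2.KT × KillingE2.KT))
      (F : KillingE2.KT × KillingE2.KT → Fin 4 → ℝ × ℝ), KillingE2.IsFociBranch W F →
      ∀ i : Fin 9, AnalyticOnNhd ℝ (fun z => KillingE2.fundInv F z i) W ∧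
        KillingE2.IsJointInvariantOn W (fun z => KillingE2.fundInv F z i)) ∧
    -- Near each pair with foci in general position they are functionally independent, and each
    -- joint invariant is a function of them, as regular as the invariant itself.
    (∀ (W : Set (KillingE2.KT × KillingE2.KT))
      (F : KillingE2.KT × KillingE2.KT → Fin 4 → ℝ × ℝ), KillingE2.IsFociBranch W F →
      ∀ z₀ ∈ W, KillingE2.GeneralPosition (F z₀) →
        LinearIndependent ℝ
          (fun i : Fin 9 => fderiv ℝ (fun z => KillingE2.fundInv F z i) z₀) ∧
        ∀ (V : Set (KillingE2.KT × KillingE2.KT)), IsOpen V → z₀ ∈ V →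
          ∀ J : KillingE2.KT × KillingE2.KT → ℝ, KillingE2.IsJointInvariantOn V J →
            ∃ (V' : Set (KillingE2.KT × KillingE2.KT)) (O : Set (Fin 9 → ℝ))
              (Φ : (Fin 9 → ℝ) → ℝ),
              IsOpen V' ∧ z₀ ∈ V' ∧ V' ⊆ V ∧ V' ⊆ W ∧ IsOpen O ∧
              (∀ z ∈ V', KillingE2.fundInv F z ∈ O ∧ J z = Φ (KillingE2.fundInv F z)) ∧
              ∀ n : WithTop ℕ∞, ContDiffOn ℝ n J V → ContDiffOn ℝ n Φ O) := by
  refine ⟨fun β => KillingE2.ncard_foci,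
    fun z₀ h₁ h₂ p => KillingE2.exists_isFociBranch h₁ h₂,
    fun g β => ⟨KillingE2.inv₁_act g β, KillingE2.inv₂_act g β, KillingE2.inv₃_act g β⟩,
    ⟨KillingE2.isOpen_genericPairs, KillingE2.dense_genericPairs⟩,
    fun W F hF i => ⟨fun z hz => hF.analyticAt_fundInv hz i, hF.isJointInvariantOn_fundInv i⟩,
    fun W F hF z₀ hz₀ hg => ⟨hF.linearIndependent_fderiv hz₀ hg,
      fun V hV hzV J hJ => hF.exists_eq_comp_fundInv hz₀ hg hV hzV hJ⟩⟩
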